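/- An $(a,b)$-module is a free $\mathbb{C}[[b]]$-module $E$ of finite rank with a $\mathbb{C}$-linear endomorphism $a$ such that $ab-ba=b^2$; it is regular if it embeds as an $a$-stable $\mathbb{C}[[b]]$-submodule into an $(a,b)$-module $E'$ with $aE'\subset bE'$. For $\lambda\in\mathbb{C}$ let $E_\lambda=\mathbb{C}[[b]]e_\lambda$ be the elementary $(a,b)$-module of rank one with $ae_\lambda=\lambda be_\lambda$. The dual $E^*$ is $\mathrm{Hom}_{\mathbb{C}[[b]]}(E,E_0)$ with $(a\cdot\varphi)(x)=a\varphi(x)-\varphi(ax)$, the conjugate $\breve E$ is the set $E$ with the signs of both $a$ and $b$ reversed, the adjoint of $E$ is the conjugate of $E^*$, and $E$ is self-adjoint if it is isomorphic (as an $(a,b)$-module) to its adjoint. Theorem. Let $E$ be a self-adjoint regular $(a,b)$-module of rank $n$. Then $E$ admits a self-adjoint Jordan–Hölder composition series, that is, there are $a$-stable $\mathbb{C}[[b]]$-submodules $$0=F_0\subsetneq F_1\subsetneq\dots\subsetneq F_n=E$$ with every $E/F_j$ free over $\mathbb{C}[[b]]$, and complex numbers $\lambda_1,\dots,\lambda_n$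 with $F_j/F_{j-1}\simeq E_{\lambda_j}$ for $1\le j\le n$, such that $\lambda_{n-j+1}=-\lambda_j$ for all $1\le j\le n$ and $F_{n-j}/F_j$ is self-adjoint for all $0\le j\le[n/2]$. -/

import Mathlib

open scoped PowerSeries

universe u v

/-- A `ℂ⟦b⟧`-module (the variable `X` acts as `b`) with a `ℂ`-linear endomorphism `a` such that
`a b - b a = b ^ 2`; the module may have torsion. -/
class ABStructure (E : Type u) [AddCommGroup E] [Module ℂ⟦X⟧ E] where
  /-- the operator `a` -/
  a : E →+ E
  a_const_smul : ∀ (c : ℂ) (x : E), a (PowerSeries.C c • x) = PowerSeries.C c • a x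
  a_b : ∀ x : E, a ((PowerSeries.X : ℂ⟦X⟧) • x) - (PowerSeries.X : ℂ⟦X⟧) • a x
    = (PowerSeries.X ^ 2 : ℂ⟦X⟧) • x

/-- An (a,b)-module: such a structure on a free `ℂ⟦b⟧`-module of finite rank. -/
class ABModule (E : Type u) [AddCommGroup E] [Module ℂ⟦X⟧ E] extends
  ABStructure E, Module.Free ℂ⟦X⟧ E, Module.Finite ℂ⟦X⟧ E

/-- Isomorphism of `ℂ⟦b⟧`-modules compatible with `a`. -/
def ABIsomorphic (E : Type u) [AddCommGroup E] [Module ℂ⟦X⟧ E] [ABStructure E]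
    (F : Type v) [AddCommGroup F] [Module ℂ⟦X⟧ F] [ABStructure F] : Prop :=
  ∃ f : E ≃ₗ[ℂ⟦X⟧] F, ∀ x : E, f (ABStructure.a x) = ABStructure.a (f x)

/-- `E` is regular: it embeds as a sub-(a,b)-module into an (a,b)-module `E'` with
`a E' ⊆ b E'`. -/
def ABRegular (E : Type u) [AddCommGroup E] [Module ℂ⟦X⟧ E] [ABStructure E] : Prop :=
  ∃ (E' : Type u) (_ : AddCommGroup E') (_ : Module ℂ⟦X⟧ E') (_ : ABModule E'),
    (∀ x : E', ∃ y : E', ABStructure.a x = (PowerSeries.X : ℂ⟦X⟧) • y) ∧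
    ∃ f : E →ₗ[ℂ⟦X⟧] E', Function.Injective f ∧
      ∀ x : E, f (ABStructure.a x) = ABStructure.a (f x)

/-! ### Elementary (a,b)-modules -/

/-- The underlying module `ℂ⟦b⟧ e_l` of the elementary (a,b)-module of parameter `l`;
the generator `e_l` is `1`. -/
def ABElementary (_l : ℂ) : Type := ℂ⟦X⟧

namespace ABElementary

variable (l : ℂ)

noncomputable instance : AddCommGroup (ABElementary l) := inferInstanceAs (AddCommGroup ℂ⟦X⟧)

noncomputable instance : Module ℂ⟦X⟧ (ABElementary l) := inferInstanceAs (Module ℂ⟦X⟧ ℂ⟦X⟧)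

instance : Module.Free ℂ⟦X⟧ (ABElementary l) := inferInstanceAs (Module.Free ℂ⟦X⟧ ℂ⟦X⟧)

instance : Module.Finite ℂ⟦X⟧ (ABElementary l) := inferInstanceAs (Module.Finite ℂ⟦X⟧ ℂ⟦X⟧)

/-- The operator `a (S e_l) = (l b S + b ^ 2 S') e_l`, which is the one with `a e_l = l b e_l`. -/
noncomputable def aHom : ℂ⟦X⟧ →+ ℂ⟦X⟧ where
  toFun S := PowerSeries.C l * PowerSeries.X * S
    + PowerSeries.X ^ 2 * PowerSeries.derivative ℂ S
  map_zero' := by simp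
  map_add' S T := by rw [map_add]; ring

theorem aHom_const (c : ℂ) (S : ℂ⟦X⟧) :
    aHom l (PowerSeries.C c * S) = PowerSeries.C c * aHom l S := by
  simp only [aHom, AddMonoidHom.coe_mk, ZeroHom.coe_mk, Derivation.leibniz,
    PowerSeries.derivative_C, smul_eq_mul]
  ring

theorem aHom_X (S : ℂ⟦X⟧) :
    aHom l (PowerSeries.X * S) - PowerSeries.X * aHom l S = PowerSeries.X ^ 2 * S := by
  simp only [aHom, AddMonoidHom.coe_mk, ZeroHom.coe_mk, Derivation.leibniz,
    PowerSeries.derivative_X, smul_eq_mul]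
  ring

noncomputable instance : ABModule (ABElementary l) where
  a := aHom l
  a_const_smul := aHom_const l
  a_b := aHom_X l

end ABElementary

/-! ### Dual, conjugate and adjoint -/

/-- The underlying module `Hom_{ℂ⟦b⟧}(E, E_0)` of the dual. -/
def ABDual (E : Type u) [AddCommGroup E] [Module ℂ⟦X⟧ E] : Type u :=
  E →ₗ[ℂ⟦X⟧] ABElementary 0

namespace ABDual

variable (E : Type u) [AddCommGroup E] [Module ℂ⟦X⟧ E]

noncomputable instance : AddCommGroup (ABDual E) :=
  inferInstanceAs (AddCommGroup (E →ₗ[ℂ⟦X⟧] ABElementary 0))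

noncomputable instance : Module ℂ⟦X⟧ (ABDual E) :=
  inferInstanceAs (Module ℂ⟦X⟧ (E →ₗ[ℂ⟦X⟧] ABElementary 0))

variable {E} [ABStructure E]

/-- The defect of `ℂ⟦b⟧`-linearity of `x ↦ a φ(x) - φ(a x)` is infinitely `b`-divisible. -/
theorem aux_dvd (φ : E →ₗ[ℂ⟦X⟧] ABElementary 0) (x : E) (n : ℕ) :
    ∀ S : ℂ⟦X⟧, ∃ T : ABElementary 0,
      (ABStructure.a (φ (S • x)) - φ (ABStructure.a (S • x)))
        - S • (ABStructure.a (φ x) - φ (ABStructure.a x))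
      = (PowerSeries.X ^ n : ℂ⟦X⟧) • T := by
  induction n with
  | zero => exact fun S => ⟨_, by rw [pow_zero, one_smul]⟩
  | succ n ih =>
    intro S
    obtain ⟨T, hT⟩ := ih (PowerSeries.mk fun p => PowerSeries.coeff (p + 1) S)
    refine ⟨T, ?_⟩
    have hS := S.eq_X_mul_shift_add_const
    set S₁ : ℂ⟦X⟧ := PowerSeries.mk fun p => PowerSeries.coeff (p + 1) S
    rw [hS, pow_succ', mul_smul, ← hT]
    simp only [add_smul, mul_smul, map_add, map_smul]
    rw [ABStructure.a_const_smul, ABStructure.a_const_smul,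
      sub_eq_iff_eq_add.mp (ABStructure.a_b (S₁ • φ x)),
      sub_eq_iff_eq_add.mp (ABStructure.a_b (S₁ • x))]
    simp only [map_add, map_smul, smul_sub]
    abel

theorem aux_smul (φ : E →ₗ[ℂ⟦X⟧] ABElementary 0) (S : ℂ⟦X⟧) (x : E) :
    ABStructure.a (φ (S • x)) - φ (ABStructure.a (S • x))
      = S • (ABStructure.a (φ x) - φ (ABStructure.a x)) := by
  rw [← sub_eq_zero]
  refine PowerSeries.ext fun m => ?_
  obtain ⟨T, hT⟩ := aux_dvd φ x (m + 1) S
  rw [hT]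
  exact PowerSeries.X_pow_dvd_iff.mp (Dvd.intro (T : ℂ⟦X⟧) rfl) m (Nat.lt_succ_self m)

/-- `(a · φ)(x) = a φ(x) - φ(a x)` -/
noncomputable def aFun (φ : E →ₗ[ℂ⟦X⟧] ABElementary 0) : E →ₗ[ℂ⟦X⟧] ABElementary 0 where
  toFun x := ABStructure.a (φ x) - φ (ABStructure.a x)
  map_add' x y := by simp only [map_add]; abel
  map_smul' S x := aux_smul φ S x

/-- The operator `a` of the dual. -/
noncomputable def aHom : (E →ₗ[ℂ⟦X⟧] ABElementary 0) →+ (E →ₗ[ℂ⟦X⟧] ABElementary 0) where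
  toFun := aFun
  map_zero' := by ext x; simp [aFun]
  map_add' φ ψ := by
    ext x
    simp only [aFun, LinearMap.coe_mk, AddHom.coe_mk, LinearMap.add_apply, map_add]
    abel

theorem aHom_const (c : ℂ) (φ : E →ₗ[ℂ⟦X⟧] ABElementary 0) :
    aHom (PowerSeries.C c • φ) = PowerSeries.C c • aHom φ := by
  refine LinearMap.ext fun x => ?_
  change ABStructure.a (PowerSeries.C c • φ x) - PowerSeries.C c • φ (ABStructure.a x)
    = PowerSeries.C c • (ABStructure.a (φ x) - φ (ABStructure.a x))
  rw [ABStructure.a_const_smul, smul_sub]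

theorem aHom_X (φ : E →ₗ[ℂ⟦X⟧] ABElementary 0) :
    aHom ((PowerSeries.X : ℂ⟦X⟧) • φ) - (PowerSeries.X : ℂ⟦X⟧) • aHom φ
      = (PowerSeries.X ^ 2 : ℂ⟦X⟧) • φ := by
  refine LinearMap.ext fun x => ?_
  change (ABStructure.a ((PowerSeries.X : ℂ⟦X⟧) • φ x)
      - (PowerSeries.X : ℂ⟦X⟧) • φ (ABStructure.a x))
    - (PowerSeries.X : ℂ⟦X⟧) • (ABStructure.a (φ x) - φ (ABStructure.a x))
    = (PowerSeries.X ^ 2 : ℂ⟦X⟧) • φ x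
  rw [← ABStructure.a_b, smul_sub]
  abel

noncomputable instance : ABStructure (ABDual E) where
  a := aHom
  a_const_smul := aHom_const
  a_b := aHom_X

end ABDual

/-- The set `E` with the signs of `a` and `b` reversed. -/
def ABConj (E : Type u) : Type u := E

namespace ABConj

variable (E : Type u) [AddCommGroup E] [Module ℂ⟦X⟧ E]

instance : AddCommGroup (ABConj E) := inferInstanceAs (AddCommGroup E)

/-- `S(b)` acts on the conjugate as `S(-b)` acts on `E`. -/
noncomputable instance : Module ℂ⟦X⟧ (ABConj E) :=
  Module.compHom E (PowerSeries.evalNegHom : ℂ⟦X⟧ →+* ℂ⟦X⟧)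

variable {E}

theorem smul_def (S : ℂ⟦X⟧) (x : E) :
    (S • (show ABConj E from x) : ABConj E) = (PowerSeries.evalNegHom S • x : E) := rfl

theorem evalNegHom_C (c : ℂ) :
    PowerSeries.evalNegHom (PowerSeries.C c) = (PowerSeries.C c : ℂ⟦X⟧) := by
  ext n
  rw [PowerSeries.evalNegHom, PowerSeries.coeff_rescale, PowerSeries.coeff_C]
  split_ifs with h <;> simp [h]

theorem neg_a_const [ABStructure E] (c : ℂ) (x : E) :
    -ABStructure.a (PowerSeries.evalNegHom (PowerSeries.C c) • x)
      = (PowerSeries.evalNegHom (PowerSeries.C c) : ℂ⟦X⟧) • -ABStructure.a x := by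
  rw [evalNegHom_C, ABStructure.a_const_smul, smul_neg]

theorem neg_a_X [ABStructure E] (x : E) :
    -ABStructure.a (PowerSeries.evalNegHom (PowerSeries.X : ℂ⟦X⟧) • x)
      - PowerSeries.evalNegHom (PowerSeries.X : ℂ⟦X⟧) • -ABStructure.a x
      = PowerSeries.evalNegHom (PowerSeries.X ^ 2 : ℂ⟦X⟧) • x := by
  rw [map_pow, PowerSeries.evalNegHom_X, neg_sq, ← ABStructure.a_b x]
  simp only [neg_smul, smul_neg, map_neg, neg_neg]

noncomputable instance [ABStructure E] : ABStructure (ABConj E) where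
  a := -(ABStructure.a : E →+ E)
  a_const_smul := neg_a_const (E := E)
  a_b := neg_a_X (E := E)

end ABConj

/-- The adjoint: the conjugate of the dual. -/
abbrev ABAdjoint (E : Type u) [AddCommGroup E] [Module ℂ⟦X⟧ E] : Type u := ABConj (ABDual E)

/-- `E` is self-adjoint if it is isomorphic to its adjoint. -/
def ABSelfAdjoint (E : Type u) [AddCommGroup E] [Module ℂ⟦X⟧ E] [ABStructure E] : Prop :=
  ABIsomorphic E (ABAdjoint E)

/-! ### Submodules, quotients and composition series -/

/-- Sub-`ℂ⟦b⟧`-modules stable under `a`. -/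
structure ABSubmodule (E : Type u) [AddCommGroup E] [Module ℂ⟦X⟧ E] [ABStructure E] extends
    Submodule ℂ⟦X⟧ E where
  a_mem : ∀ x ∈ toSubmodule, ABStructure.a x ∈ toSubmodule

namespace ABSubmodule

variable {E : Type u} [AddCommGroup E] [Module ℂ⟦X⟧ E] [ABStructure E]

/-- The operator `a` restricted to a submodule. -/
noncomputable instance (F : ABSubmodule E) : ABStructure F.toSubmodule where
  a := ((ABStructure.a : E →+ E).comp F.toSubmodule.toAddSubgroup.subtype).codRestrict
    F.toSubmodule.toAddSubgroup fun x => F.a_mem x.1 x.2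
  a_const_smul c x := Subtype.ext (ABStructure.a_const_smul c x.1)
  a_b x := Subtype.ext (ABStructure.a_b x.1)

/-- The operator `a` induced on the quotient. -/
noncomputable instance (F : ABSubmodule E) : ABStructure (E ⧸ F.toSubmodule) where
  a := QuotientAddGroup.map F.toSubmodule.toAddSubgroup F.toSubmodule.toAddSubgroup
    (ABStructure.a : E →+ E) F.a_mem
  a_const_smul c x := Submodule.Quotient.induction_on _ x fun y =>
    congrArg (Submodule.Quotient.mk (p := F.toSubmodule)) (ABStructure.a_const_smul c y)
  a_b x := Submodule.Quotient.induction_on _ x fun y =>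
    congrArg (Submodule.Quotient.mk (p := F.toSubmodule)) (ABStructure.a_b y)

/-- `F` is normal in `E` if `E / F` is free over `ℂ⟦b⟧`. -/
def Normal (F : ABSubmodule E) : Prop := Module.Free ℂ⟦X⟧ (E ⧸ F.toSubmodule)

/-- `F ∩ G` as a submodule of `G`. -/
noncomputable def within (F G : ABSubmodule E) : ABSubmodule G.toSubmodule where
  toSubmodule := F.toSubmodule.submoduleOf G.toSubmodule
  a_mem x hx := F.a_mem x.1 hx

/-- The quotient `G / F` for `F ≤ G` (in general `G / (F ∩ G)`). -/
abbrev Quot (G F : ABSubmodule E) : Type u := G.toSubmodule ⧸ (F.within G).toSubmodule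

end ABSubmodule

/-- A Jordan–Hölder composition series `0 = F_0 ⊊ F_1 ⊊ ⋯ ⊊ F_n = E` with all `F_j` normal in `E`
and `F_j / F_{j-1}` elementary of parameter `l_j`; `param j` is `l_{j+1}` as `Fin n` starts
at `0`. -/
structure ABJordanHolder (E : Type u) [AddCommGroup E] [Module ℂ⟦X⟧ E] [ABStructure E]
    (n : ℕ) where
  F : Fin (n + 1) → ABSubmodule E
  F_zero : (F 0).toSubmodule = ⊥
  F_last : (F (Fin.last n)).toSubmodule = ⊤
  F_lt : ∀ j : Fin n, (F j.castSucc).toSubmodule < (F j.succ).toSubmodule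
  normal : ∀ j, (F j).Normal
  param : Fin n → ℂ
  quot_iso : ∀ j : Fin n,
    ABIsomorphic ((F j.succ).Quot (F j.castSucc)) (ABElementary (param j))

/-- The series is self-adjoint: `l_{n-j+1} = - l_j` for `1 ≤ j ≤ n`, and `F_{n-j} / F_j` is
self-adjoint for `0 ≤ j ≤ [n/2]`. (`Fin.rev j` is `n - 1 - j` in `Fin n` and `n - j` in
`Fin (n + 1)`.) -/
def ABJordanHolder.IsSelfAdjoint {E : Type u} [AddCommGroup E] [Module ℂ⟦X⟧ E] [ABStructure E]
    {n : ℕ} (s : ABJordanHolder E n) : Prop :=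
  (∀ j : Fin n, s.param (Fin.rev j) = -s.param j) ∧
  ∀ j : Fin (n + 1), (j : ℕ) ≤ n / 2 → ABSelfAdjoint ((s.F (Fin.rev j)).Quot (s.F j))

/-!
Self-adjointness of `E` means that `E` carries a perfect form `B` with values in `ℂ⟦b⟧`, linear in
the second variable, semilinear for `S(b) ↦ S(-b)` in the first one, and satisfying
`B x (a y) - B (a x) y = b ^ 2 (B x y)'` (`abSelfAdjoint_iff_nonempty_form`). The form need not be
hermitian or antihermitian; its asymmetry is the endomorphism `u` of `E` with
`B (u x) y = (B y x)(-b)` (`ABForm.exists_asymmetry`).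

Suppose `a e = l b e`, that `e` is not in `b E`, that `e` is an eigenvector of `u` over `ℂ`, and
that `B e e = 0`. Then the left and right orthogonals of `e` agree, `B` induces a perfect form on
`e^⊥ / ⟨e⟩` (`ABForm.nonempty_form_reduction`), `⟨e⟩` is elementary of parameter `l`, and `B e`
identifies `E / e^⊥` with the elementary module of parameter `-l`. Since `e^⊥ / ⟨e⟩` is again
regular, a self-adjoint series for it, pulled back and completed by `0` and `E`, is one for `E`
(`HasSelfAdjointSeries.of_reduction`). The induction on the rank starts with rank zero and with rank
one, where the module has to be `E_0`.

It remains to find such an `e` in rank at least two. Regularity provides nonzero eigenvectors of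
`b⁻¹ a` in every nonzero `a`-stable submodule (`ABRegular.exists_eigen_mem`): inside a lattice
stable under `b⁻¹ a` this is the formal solution of a differential equation with a simple pole. On the
eigenvectors `x`, `y` of parameters `l`, `m` the form takes values in `ℂ b ^ (l + m)`, hence
vanishes unless `l + m` is a natural number. If some eigenspace has dimension at least two, linear
algebra over `ℂ` gives an isotropic eigenvector of `u` in it (`ABForm.exists_isotropic_of_two`).
Otherwise, if no isotropic eigenvector exists, pairwise orthogonal eigenvectors have half-integral
parameters in distinct classes modulo `ℤ`; there are two such classes, so the rank is two and the
Gram determinant of two orthogonal eigenvectors has odd valuation, whereas the valuation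
of any nonzero Gram determinant is even (`ABForm.exists_even_order_of_gram`).
-/

open PowerSeries ABStructure

/-! ### Power series and `b`-adic properties of free modules -/

theorem exists_X_pow_mul_isUnit {S : ℂ⟦X⟧} (hS : S ≠ 0) :
    ∃ (k : ℕ) (U : ℂ⟦X⟧), IsUnit U ∧ S = X ^ k * U :=
  ⟨_, _, (Unit_of_divided_by_X_pow_order S).isUnit, by
    rw [Unit_of_divided_by_X_pow_order_nonzero hS, X_pow_order_mul_divXPowOrder]⟩

theorem coeff_evalNegHom (S : ℂ⟦X⟧) (k : ℕ) :
    coeff k (evalNegHom S) = (-1) ^ k * coeff k S := by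
  rw [evalNegHom, coeff_rescale]

theorem evalNegHom_evalNegHom (S : ℂ⟦X⟧) : evalNegHom (evalNegHom S) = S := by
  ext k
  rw [coeff_evalNegHom, coeff_evalNegHom, ← mul_assoc, ← mul_pow]
  simp

theorem derivative_evalNegHom (S : ℂ⟦X⟧) :
    derivative ℂ (evalNegHom S) = -evalNegHom (derivative ℂ S) := by
  ext k
  rw [map_neg, coeff_evalNegHom, coeff_derivative, coeff_derivative, coeff_evalNegHom, pow_succ]
  ring

theorem evalNegHom_injective : Function.Injective (evalNegHom : ℂ⟦X⟧ →+* ℂ⟦X⟧) :=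
  Function.LeftInverse.injective evalNegHom_evalNegHom

section Free

variable {E : Type u} [AddCommGroup E] [Module ℂ⟦X⟧ E]

theorem X_pow_smul_injective [Module.Free ℂ⟦X⟧ E] (k : ℕ) {x y : E}
    (h : (X ^ k : ℂ⟦X⟧) • x = (X ^ k : ℂ⟦X⟧) • y) : x = y :=
  smul_right_injective E (pow_ne_zero k X_ne_zero) h

theorem X_smul_injective [Module.Free ℂ⟦X⟧ E] {x y : E}
    (h : (X : ℂ⟦X⟧) • x = (X : ℂ⟦X⟧) • y) : x = y :=
  smul_right_injective E X_ne_zero h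

/-- A free `ℂ⟦b⟧`-module is `b`-adically separated. -/
theorem eq_zero_of_forall_X_pow_smul [Module.Free ℂ⟦X⟧ E] {x : E}
    (h : ∀ k : ℕ, ∃ y : E, x = (X ^ k : ℂ⟦X⟧) • y) : x = 0 := by
  let β := Module.Free.chooseBasis ℂ⟦X⟧ E
  refine β.repr.map_eq_zero_iff.mp (Finsupp.ext fun i => PowerSeries.ext fun m => ?_)
  obtain ⟨y, rfl⟩ := h (m + 1)
  rw [map_smul, Finsupp.smul_apply, smul_eq_mul]
  exact X_pow_dvd_iff.mp (Dvd.intro _ rfl) m m.lt_succ_self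

/-- A nonzero element of a free module is a power of `b` times an element outside `b E`. -/
theorem exists_primitive [Module.Free ℂ⟦X⟧ E] {x : E} (hx : x ≠ 0) :
    ∃ (k : ℕ) (y : E), x = (X ^ k : ℂ⟦X⟧) • y ∧ ∀ z : E, y ≠ (X : ℂ⟦X⟧) • z := by
  classical
  have h : ∃ k : ℕ, ¬ ∃ y : E, x = (X ^ k : ℂ⟦X⟧) • y := by
    by_contra! h
    exact hx (eq_zero_of_forall_X_pow_smul h)
  have h0 : Nat.find h ≠ 0 := fun h0 =>
    (h0 ▸ Nat.find_spec h) ⟨x, by rw [pow_zero, one_smul]⟩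
  obtain ⟨y, hy⟩ := not_not.mp (Nat.find_min h (Nat.sub_one_lt h0))
  refine ⟨_, y, hy, fun z hz => Nat.find_spec h ⟨z, hy.trans ?_⟩⟩
  rw [hz, smul_smul, ← pow_succ, Nat.sub_one_add_one h0]

/-- A quotient of a finite module is free as soon as it has no `b`-torsion. -/
theorem free_quotient_iff [Module.Finite ℂ⟦X⟧ E] (F : Submodule ℂ⟦X⟧ E) :
    Module.Free ℂ⟦X⟧ (E ⧸ F) ↔ ∀ x : E, (X : ℂ⟦X⟧) • x ∈ F → x ∈ F := by
  constructor
  · intro _ x hx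
    rw [← Submodule.Quotient.mk_eq_zero]
    refine X_smul_injective (E := E ⧸ F) ?_
    rw [smul_zero, ← Submodule.Quotient.mk_smul, (Submodule.Quotient.mk_eq_zero F).mpr hx]
  · intro h
    have h' : ∀ (k : ℕ) (x : E), (X ^ k : ℂ⟦X⟧) • x ∈ F → x ∈ F := by
      intro k
      induction k with
      | zero => intro x hx; simpa using hx
      | succ k ih => intro x hx; exact ih x (h _ (by rwa [smul_smul, ← pow_succ']))
    rw [Module.free_iff_isTorsionFree, Module.isTorsionFree_iff_smul_eq_zero]
    intro S x hSx
    refine or_iff_not_imp_left.mpr fun hS => ?_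
    obtain ⟨k, U, hU, rfl⟩ := exists_X_pow_mul_isUnit hS
    induction x using Submodule.Quotient.induction_on with
    | H x =>
      rw [← Submodule.Quotient.mk_smul, Submodule.Quotient.mk_eq_zero, mul_smul] at hSx
      obtain ⟨U, rfl⟩ := hU
      have := F.smul_mem (↑U⁻¹ : ℂ⟦X⟧) (h' k _ hSx)
      rwa [smul_smul, Units.inv_mul, one_smul, ← Submodule.Quotient.mk_eq_zero] at this

end Free

/-! ### The operator `a` and its eigenvectors -/

section Operator

variable {E : Type u} [AddCommGroup E] [Module ℂ⟦X⟧ E] [ABStructure E]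

theorem a_X_smul (x : E) :
    a ((X : ℂ⟦X⟧) • x) = (X : ℂ⟦X⟧) • a x + (X ^ 2 : ℂ⟦X⟧) • x := by
  rw [← a_b x]; abel

theorem a_X_pow_smul (k : ℕ) (x : E) :
    a ((X ^ k : ℂ⟦X⟧) • x) = (X ^ k : ℂ⟦X⟧) • a x + (C (k : ℂ) * X ^ (k + 1) : ℂ⟦X⟧) • x := by
  induction k with
  | zero => simp
  | succ k ih =>
    rw [pow_succ', mul_smul, a_X_smul, ih, smul_add, smul_smul, smul_smul, smul_smul, add_assoc,
      ← add_smul]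
    congr 2
    rw [Nat.cast_succ, map_add, map_one]
    ring

/-- The Leibniz rule `a (S x) = S a x + b ^ 2 S' x`. -/
theorem a_smul [Module.Free ℂ⟦X⟧ E] (S : ℂ⟦X⟧) (x : E) :
    a (S • x) = S • a x + (X ^ 2 * derivative ℂ S : ℂ⟦X⟧) • x := by
  rw [← sub_eq_zero]
  refine eq_zero_of_forall_X_pow_smul fun k => ?_
  -- The defect of the rule at `S₁ b + c` is `b` times the defect at `S₁`.
  induction k generalizing S with
  | zero => exact ⟨_, by rw [pow_zero, one_smul]⟩
  | succ k ih =>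
    obtain ⟨S₁, c, rfl⟩ : ∃ (S₁ : ℂ⟦X⟧) (c : ℂ), S = X * S₁ + C c :=
      ⟨_, _, S.eq_X_mul_shift_add_const⟩
    obtain ⟨y, hy⟩ := ih S₁
    refine ⟨y, ?_⟩
    rw [pow_succ' _ k, mul_smul X (X ^ k) y, ← hy, add_smul, map_add, a_const_smul,
      mul_smul, a_X_smul]
    have hd : X ^ 2 * derivative ℂ (X * S₁ + C c)
        = X * (X ^ 2 * derivative ℂ S₁) + X ^ 2 * S₁ := by
      simp only [map_add, Derivation.leibniz, derivative_C, derivative_X, smul_eq_mul]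
      ring
    rw [hd]
    simp only [add_smul, mul_smul, smul_sub, smul_add]
    abel

/-- `x` satisfies `a x = l b x`. -/
def IsABEigen (l : ℂ) (x : E) : Prop := a x = (C l * X : ℂ⟦X⟧) • x

theorem IsABEigen.add {l : ℂ} {x y : E} (hx : IsABEigen l x) (hy : IsABEigen l y) :
    IsABEigen l (x + y) := by
  rw [IsABEigen, map_add, hx, hy, smul_add]

theorem IsABEigen.C_smul {l : ℂ} {x : E} (hx : IsABEigen l x) (c : ℂ) :
    IsABEigen l ((C c : ℂ⟦X⟧) • x) := by
  rw [IsABEigen, a_const_smul, hx, smul_comm]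

theorem IsABEigen.X_pow_smul {l : ℂ} {x : E} (hx : IsABEigen l x) (k : ℕ) :
    IsABEigen (l + k) ((X ^ k : ℂ⟦X⟧) • x) := by
  rw [IsABEigen, a_X_pow_smul, hx, smul_smul, smul_smul, ← add_smul, map_add]
  congr 1
  ring

theorem IsABEigen.of_X_pow_smul [Module.Free ℂ⟦X⟧ E] {l : ℂ} {x : E} {k : ℕ}
    (hx : IsABEigen l ((X ^ k : ℂ⟦X⟧) • x)) : IsABEigen (l - k) x := by
  rw [IsABEigen, a_X_pow_smul, ← eq_sub_iff_add_eq] at hx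
  refine X_pow_smul_injective k ?_
  rw [hx, smul_smul, smul_smul, ← sub_smul, map_sub]
  congr 1
  ring

/-- Eigenvectors of the same parameter which satisfy a `ℂ⟦b⟧`-linear relation satisfy the
relation between the constant terms as well: the relations are stable under `S ↦ b S'`, and
`S - b S' / (k + 1)` has the constant term of `S` and loses the coefficient of `b ^ (k + 1)`. -/
theorem sum_constantCoeff_smul_eq_zero [Module.Free ℂ⟦X⟧ E] {ι : Type*} (s : Finset ι) {l : ℂ}
    {x : ι → E} (hx : ∀ i ∈ s, IsABEigen l (x i)) {S : ι → ℂ⟦X⟧}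
    (hS : ∑ i ∈ s, S i • x i = 0) : ∑ i ∈ s, C (constantCoeff (S i)) • x i = 0 := by
  have key : ∀ k : ℕ, ∃ T : ι → ℂ⟦X⟧, ∑ i ∈ s, T i • x i = 0 ∧
      ∀ i ∈ s, (X ^ (k + 1) : ℂ⟦X⟧) ∣ T i - C (constantCoeff (S i)) := by
    intro k
    induction k with
    | zero =>
      refine ⟨S, hS, fun i _ => ?_⟩
      rw [zero_add, pow_one, X_dvd_iff]
      simp
    | succ k ih =>
      obtain ⟨T, hT, hdvd⟩ := ih
      have hT' : ∑ i ∈ s, (X * derivative ℂ (T i)) • x i = 0 := by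
        refine X_smul_injective ?_
        rw [smul_zero, Finset.smul_sum]
        have h : a (∑ i ∈ s, T i • x i) - (C l * X : ℂ⟦X⟧) • ∑ i ∈ s, T i • x i = 0 := by
          rw [hT, map_zero, smul_zero, sub_zero]
        rw [map_sum, Finset.smul_sum, ← Finset.sum_sub_distrib] at h
        rw [← h]
        refine Finset.sum_congr rfl fun i hi => ?_
        rw [a_smul, hx i hi]
        simp only [smul_smul, ← add_smul, ← sub_smul]
        congr 1
        ring
      refine ⟨fun i => T i - C ((k + 1 : ℂ)⁻¹) * (X * derivative ℂ (T i)), ?_, fun i hi => ?_⟩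
      · simp only [sub_smul, mul_smul (C _), Finset.sum_sub_distrib, ← Finset.smul_sum, hT, hT',
          smul_zero, sub_zero]
      · rw [X_pow_dvd_iff]
        have hd := X_pow_dvd_iff.mp (hdvd i hi)
        intro m hm
        have hk : (k + 1 : ℂ) ≠ 0 := by exact_mod_cast k.succ_ne_zero
        rcases m with _ | m
        · have := hd 0 k.succ_pos
          simpa using this
        · have hc : coeff (m + 1) (C (constantCoeff (S i)) : ℂ⟦X⟧) = 0 := by
            rw [coeff_C, if_neg m.succ_ne_zero]
          rw [map_sub, map_sub, coeff_C_mul, coeff_succ_X_mul, coeff_derivative, hc, sub_zero]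
          rcases (Nat.lt_succ_iff_lt_or_eq.mp hm) with h | h
          · have := hd _ h
            rw [map_sub, hc, sub_zero] at this
            rw [this]
            ring
          · obtain rfl : m = k := by omega
            field_simp
            ring
  refine eq_zero_of_forall_X_pow_smul fun k => ?_
  obtain ⟨T, hT, hdvd⟩ := key k
  have h1 : ∀ i ∈ s, ∃ y : E, C (constantCoeff (S i)) • x i - T i • x i
      = (X ^ k : ℂ⟦X⟧) • y := by
    intro i hi
    obtain ⟨D, hD⟩ := hdvd i hi
    refine ⟨(-(X * D)) • x i, ?_⟩
    rw [← sub_smul, ← neg_sub (T i), hD, smul_smul]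
    congr 1
    ring
  choose! y hy using h1
  refine ⟨∑ i ∈ s, y i, ?_⟩
  rw [Finset.smul_sum, ← Finset.sum_congr rfl hy, Finset.sum_sub_distrib, hT, sub_zero]

end Operator

/-! ### Isomorphisms, submodules and quotients -/

section Iso

variable {M : Type u} [AddCommGroup M] [Module ℂ⟦X⟧ M] [ABStructure M]
  {N : Type v} [AddCommGroup N] [Module ℂ⟦X⟧ N] [ABStructure N]

namespace ABSubmodule

theorem mem_within {F G : ABSubmodule M} {x : G.toSubmodule} :
    x ∈ (F.within G).toSubmodule ↔ (x : M) ∈ F.toSubmodule := Iff.rfl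

/-- The first isomorphism theorem. -/
theorem isomorphic_of_surjective (K : ABSubmodule M) (f : M →ₗ[ℂ⟦X⟧] N)
    (hf : ∀ x, f (a x) = a (f x)) (hs : Function.Surjective f)
    (hK : ∀ x, x ∈ K.toSubmodule ↔ f x = 0) : ABIsomorphic (M ⧸ K.toSubmodule) N := by
  have hker : K.toSubmodule = LinearMap.ker f := Submodule.ext fun x => by
    rw [hK, LinearMap.mem_ker]
  refine ⟨(Submodule.quotEquivOfEq _ _ hker).trans (f.quotKerEquivOfSurjective hs), fun x => ?_⟩
  induction x using Submodule.Quotient.induction_on with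
  | H x => exact hf x

/-- The third isomorphism theorem in the form used for composition series: a surjection `f` of
`A'` onto `A` for which `B'` is the preimage of `B` identifies `A' / B'` with `A / B`. -/
theorem quot_isomorphic {A' B' : ABSubmodule M} {A B : ABSubmodule N}
    (f : A'.toSubmodule →ₗ[ℂ⟦X⟧] A.toSubmodule) (hf : ∀ x, f (a x) = a (f x))
    (hs : Function.Surjective f)
    (hB : ∀ x : A'.toSubmodule, (x : M) ∈ B'.toSubmodule ↔ (f x : N) ∈ B.toSubmodule) :
    ABIsomorphic (A'.Quot B') (A.Quot B) := by
  refine isomorphic_of_surjective (B'.within A') ((B.within A).toSubmodule.mkQ.comp f)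
    (fun x => ?_) ((Submodule.mkQ_surjective _).comp hs) fun x => ?_
  · rw [LinearMap.comp_apply, hf]
    rfl
  · rw [mem_within, hB, LinearMap.comp_apply, Submodule.mkQ_apply,
      Submodule.Quotient.mk_eq_zero, mem_within]

/-- The submodule `0`. -/
noncomputable def zero (M : Type u) [AddCommGroup M] [Module ℂ⟦X⟧ M] [ABStructure M] :
    ABSubmodule M where
  toSubmodule := ⊥
  a_mem x hx := by rw [Submodule.mem_bot] at hx ⊢; rw [hx, map_zero]

/-- The submodule `M`. -/
noncomputable def whole (M : Type u) [AddCommGroup M] [Module ℂ⟦X⟧ M] [ABStructure M] :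
    ABSubmodule M where
  toSubmodule := ⊤
  a_mem _ _ := trivial

theorem quot_isomorphic_self {A B : ABSubmodule M} (hA : A.toSubmodule = ⊤)
    (hB : B.toSubmodule = ⊥) : ABIsomorphic (A.Quot B) M :=
  isomorphic_of_surjective _ A.toSubmodule.subtype (fun _ => rfl)
    (fun x => ⟨⟨x, hA ▸ trivial⟩, rfl⟩) fun x => by
      rw [mem_within, hB, Submodule.mem_bot, Submodule.subtype_apply]

end ABSubmodule

end Iso

/-! ### Regular modules -/

section Regular

variable {M : Type u} [AddCommGroup M] [Module ℂ⟦X⟧ M] [ABStructure M]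
  {N : Type u} [AddCommGroup N] [Module ℂ⟦X⟧ N] [ABStructure N]

theorem ABRegular.of_injective (hN : ABRegular N) (f : M →ₗ[ℂ⟦X⟧] N)
    (hf : ∀ x, f (a x) = a (f x)) (hinj : Function.Injective f) : ABRegular M := by
  obtain ⟨E', _, _, _, h, g, hg, hga⟩ := hN
  exact ⟨E', _, _, _, h, g.comp f, hg.comp hinj, fun x => by
    rw [LinearMap.comp_apply, hf, hga, LinearMap.comp_apply]⟩

/-- The elements of `N` with a multiple by a power of `b` in the image of `f`. -/
noncomputable def ABSubmodule.saturation (f : M →ₗ[ℂ⟦X⟧] N) (hf : ∀ x, f (a x) = a (f x)) :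
    ABSubmodule N where
  carrier := {y | ∃ (k : ℕ) (x : M), f x = (X ^ k : ℂ⟦X⟧) • y}
  zero_mem' := ⟨0, 0, by simp⟩
  add_mem' := by
    rintro y z ⟨k, x, hx⟩ ⟨l, x', hx'⟩
    refine ⟨k + l, (X ^ l : ℂ⟦X⟧) • x + (X ^ k : ℂ⟦X⟧) • x', ?_⟩
    rw [map_add, map_smul, map_smul, hx, hx', smul_smul, smul_smul, smul_add, pow_add,
      mul_comm (X ^ l)]
  smul_mem' := by
    rintro S y ⟨k, x, hx⟩
    exact ⟨k, S • x, by rw [map_smul, hx, smul_comm]⟩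
  a_mem := by
    rintro y ⟨k, x, hx⟩
    refine ⟨k, a x - (C (k : ℂ) * X) • x, ?_⟩
    rw [map_sub, map_smul, hf, hx, a_X_pow_smul, smul_smul, add_sub_assoc, ← sub_smul]
    simp [pow_succ', mul_assoc]

theorem ABSubmodule.mem_saturation_of_X_smul {f : M →ₗ[ℂ⟦X⟧] N} {hf : ∀ x, f (a x) = a (f x)}
    {y : N} (h : (X : ℂ⟦X⟧) • y ∈ (saturation f hf).toSubmodule) :
    y ∈ (saturation f hf).toSubmodule := by
  obtain ⟨k, x, hx⟩ := h
  exact ⟨k + 1, x, by rw [hx, smul_smul, pow_succ]⟩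

/-- The quotient of a regular module by a normal submodule is regular. -/
theorem ABRegular.quotient (hM : ABRegular M) (K : ABSubmodule M)
    (hK : ∀ x : M, (X : ℂ⟦X⟧) • x ∈ K.toSubmodule → x ∈ K.toSubmodule) :
    ABRegular (M ⧸ K.toSubmodule) := by
  obtain ⟨E', _, _, _, h, g, hg, hga⟩ := hM
  let K' : ABSubmodule E' := .saturation (g.comp K.toSubmodule.subtype) fun x => hga x
  have hfree : Module.Free ℂ⟦X⟧ (E' ⧸ K'.toSubmodule) :=
    (free_quotient_iff _).mpr fun x hx => ABSubmodule.mem_saturation_of_X_smul hx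
  have hle : K.toSubmodule ≤ K'.toSubmodule.comap g := fun x hx =>
    ⟨0, ⟨x, hx⟩, by rw [pow_zero, one_smul]; rfl⟩
  refine ⟨E' ⧸ K'.toSubmodule, inferInstance, inferInstance, { (inferInstance :
    ABStructure (E' ⧸ K'.toSubmodule)), hfree, (inferInstance : Module.Finite ℂ⟦X⟧ _) with },
    fun x => ?_, Submodule.mapQ _ _ g hle, ?_, fun x => ?_⟩
  · induction x using Submodule.Quotient.induction_on with
    | H x =>
      obtain ⟨y, hy⟩ := h x
      exact ⟨Submodule.Quotient.mk y, congrArg (Submodule.Quotient.mk (p := K'.toSubmodule)) hy⟩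
  · rw [← LinearMap.ker_eq_bot, LinearMap.ker_eq_bot']
    intro x
    induction x using Submodule.Quotient.induction_on with
    | H x =>
      intro hx
      rw [Submodule.mapQ_apply, Submodule.Quotient.mk_eq_zero] at hx
      obtain ⟨k, z, hz⟩ := hx
      rw [Submodule.Quotient.mk_eq_zero]
      have hz' : (X ^ k : ℂ⟦X⟧) • x ∈ K.toSubmodule := by
        have : (z : M) = (X ^ k : ℂ⟦X⟧) • x := hg (by rw [map_smul]; exact hz)
        exact this ▸ z.2
      clear hz
      induction k with
      | zero => simpa using hz'
      | succ k ih => exact ih (hK _ (by rwa [smul_smul, ← pow_succ']))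
  · induction x using Submodule.Quotient.induction_on with
    | H x => exact congrArg (Submodule.Quotient.mk (p := K'.toSubmodule)) (hga x)

end Regular

/-! ### Self-adjoint modules as modules with a form -/

/-- A form on `E`: additive in both variables, `ℂ⟦b⟧`-linear in the second one and semilinear
with respect to `S(b) ↦ S(-b)` in the first one, compatible with `a`, and such that `x ↦ B x`
is a bijection of `E` onto the linear forms. -/
structure ABForm (E : Type u) [AddCommGroup E] [Module ℂ⟦X⟧ E] [ABStructure E] where
  B : E →ₛₗ[(evalNegHom : ℂ⟦X⟧ →+* ℂ⟦X⟧)] E →ₗ[ℂ⟦X⟧] ℂ⟦X⟧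
  a_right : ∀ x y, B x (a y) = B (a x) y + X ^ 2 * derivative ℂ (B x y)
  injective : ∀ x, (∀ y, B x y = 0) → x = 0
  surjective : ∀ φ : E →ₗ[ℂ⟦X⟧] ℂ⟦X⟧, ∃ x, B x = φ

section Form

variable {E : Type u} [AddCommGroup E] [Module ℂ⟦X⟧ E] [ABStructure E]

theorem ABElementary.aHom_zero_apply (S : ℂ⟦X⟧) :
    aHom 0 S = X ^ 2 * derivative ℂ S := by
  change C (0 : ℂ) * X * S + X ^ 2 * derivative ℂ S = _
  rw [map_zero, zero_mul, zero_mul, zero_add]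

theorem abSelfAdjoint_iff_nonempty_form : ABSelfAdjoint E ↔ Nonempty (ABForm E) := by
  constructor
  · rintro ⟨f, hf⟩
    let B : E →ₛₗ[(evalNegHom : ℂ⟦X⟧ →+* ℂ⟦X⟧)] E →ₗ[ℂ⟦X⟧] ℂ⟦X⟧ :=
      { toFun := fun x => (f x : E →ₗ[ℂ⟦X⟧] ABElementary 0)
        map_add' := fun x y => f.map_add x y
        map_smul' := fun S x => f.map_smul S x }
    refine ⟨B, fun x y => ?_, fun x hx => ?_, fun φ => ?_⟩
    · have h : B (a x) y = -(ABElementary.aHom 0 (B x y) - B x (a y)) :=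
        congrArg (fun φ : E →ₗ[ℂ⟦X⟧] ABElementary 0 => φ y) (hf x)
      rw [ABElementary.aHom_zero_apply] at h
      rw [h]
      ring
    · refine (LinearEquiv.map_eq_zero_iff f).mp ?_
      exact LinearMap.ext (f := (f x : E →ₗ[ℂ⟦X⟧] ABElementary 0)) hx
    · exact ⟨f.symm (show E →ₗ[ℂ⟦X⟧] ABElementary 0 from φ), f.apply_symm_apply _⟩
  · rintro ⟨h⟩
    let f : E →ₗ[ℂ⟦X⟧] ABAdjoint E :=
      { toFun := fun x => (h.B x : E →ₗ[ℂ⟦X⟧] ABElementary 0)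
        map_add' := fun x y => h.B.map_add x y
        map_smul' := fun S x => h.B.map_smulₛₗ S x }
    refine ⟨LinearEquiv.ofBijective f ⟨?_, fun φ => h.surjective φ⟩, fun x => ?_⟩
    · rw [← LinearMap.ker_eq_bot, LinearMap.ker_eq_bot']
      intro x hx
      exact h.injective x fun y => congrArg (fun φ : E →ₗ[ℂ⟦X⟧] ABElementary 0 => φ y) hx
    · refine LinearMap.ext (σ := RingHom.id ℂ⟦X⟧) (f := h.B (a x)) fun y => ?_
      change h.B (a x) y = -(ABElementary.aHom 0 (h.B x y) - h.B x (a y))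
      rw [ABElementary.aHom_zero_apply, h.a_right]
      ring

theorem ABSelfAdjoint.of_isomorphic {N : Type v} [AddCommGroup N] [Module ℂ⟦X⟧ N] [ABStructure N]
    (hE : ABSelfAdjoint E) (h : ABIsomorphic N E) : ABSelfAdjoint N := by
  rw [abSelfAdjoint_iff_nonempty_form] at hE ⊢
  obtain ⟨B, h1, h2, h3⟩ := hE
  obtain ⟨f, hf⟩ := h
  let B' : N →ₛₗ[(evalNegHom : ℂ⟦X⟧ →+* ℂ⟦X⟧)] N →ₗ[ℂ⟦X⟧] ℂ⟦X⟧ :=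
    { toFun := fun x => (B (f x)).comp f.toLinearMap
      map_add' := fun x y => by ext; simp
      map_smul' := fun S x => by ext; simp }
  have hB : ∀ x y, B' x y = B (f x) (f y) := fun _ _ => rfl
  refine ⟨B', fun x y => ?_, fun x hx => ?_, fun φ => ?_⟩
  · rw [hB, hB, hB, hf, hf, h1]
  · refine f.map_eq_zero_iff.mp (h2 _ fun y => ?_)
    have := hx (f.symm y)
    rwa [hB, f.apply_symm_apply] at this
  · obtain ⟨x, hx⟩ := h3 (φ.comp f.symm.toLinearMap)
    refine ⟨f.symm x, LinearMap.ext fun y => ?_⟩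
    rw [hB, f.apply_symm_apply, hx]
    simp

namespace ABForm

variable (h : ABForm E)

theorem smul_left (S : ℂ⟦X⟧) (x y : E) : h.B (S • x) y = evalNegHom S * h.B x y := by
  rw [LinearMap.map_smulₛₗ, LinearMap.smul_apply, smul_eq_mul]

theorem C_smul_left (c : ℂ) (x y : E) : h.B ((C c : ℂ⟦X⟧) • x) y = C c * h.B x y := by
  rw [h.smul_left, ABConj.evalNegHom_C]

theorem smul_right (S : ℂ⟦X⟧) (x y : E) : h.B x (S • y) = S * h.B x y := by
  rw [map_smul, smul_eq_mul]

/-- The values of the form on eigenvectors of parameters `l` and `m` are monomials of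
degree `l + m`. -/
theorem coeff_eigen {l m : ℂ} {x y : E} (hx : IsABEigen l x) (hy : IsABEigen m y) (k : ℕ) :
    (k : ℂ) * coeff k (h.B x y) = (l + m) * coeff k (h.B x y) := by
  have h1 := h.a_right x y
  rw [hx, hy, h.smul_right, h.smul_left, map_mul, ABConj.evalNegHom_C, evalNegHom_X] at h1
  have h2 : X * derivative ℂ (h.B x y) = C (l + m) * h.B x y := by
    refine mul_left_cancel₀ (X_ne_zero (R := ℂ)) ?_
    rw [map_add]
    linear_combination -h1
  have h3 := congrArg (coeff k) h2
  rw [coeff_C_mul] at h3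
  rw [← h3]
  cases k with
  | zero => simp
  | succ k => rw [coeff_succ_X_mul, coeff_derivative]; push_cast; ring

theorem eq_zero_of_forall_ne {l m : ℂ} {x y : E} (hx : IsABEigen l x) (hy : IsABEigen m y)
    (hlm : ∀ k : ℕ, l + m ≠ k) : h.B x y = 0 := by
  ext k
  have := h.coeff_eigen hx hy k
  rw [← sub_eq_zero, ← sub_mul] at this
  exact (mul_eq_zero.mp this).resolve_left (sub_ne_zero.mpr (hlm k).symm)

theorem eq_monomial {l m : ℂ} {x y : E} (hx : IsABEigen l x) (hy : IsABEigen m y) {k : ℕ}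
    (hlm : l + m = k) : h.B x y = C (coeff k (h.B x y)) * X ^ k := by
  ext j
  rw [coeff_C_mul_X_pow]
  split_ifs with hj
  · rw [hj]
  · have := h.coeff_eigen hx hy j
    rw [← sub_eq_zero, ← sub_mul, hlm] at this
    exact (mul_eq_zero.mp this).resolve_left (sub_ne_zero.mpr (by exact_mod_cast hj))

/-- The endomorphism `u` with `B (u x) y = (B y x)(-b)`, which measures the lack of symmetry of
the form, is an injective endomorphism for the structure of (a,b)-module. -/
theorem exists_asymmetry [Module.Free ℂ⟦X⟧ E] :
    ∃ u : E →ₗ[ℂ⟦X⟧] E, (∀ x y, h.B (u x) y = evalNegHom (h.B y x)) ∧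
      (∀ x, u (a x) = a (u x)) ∧ ∀ x, u x = 0 → x = 0 := by
  have hex : ∀ x, ∃ z, ∀ y, h.B z y = evalNegHom (h.B y x) := by
    intro x
    obtain ⟨z, hz⟩ := h.surjective
      { toFun := fun y => evalNegHom (h.B y x)
        map_add' := fun y y' => by rw [map_add, LinearMap.add_apply, map_add]
        map_smul' := fun S y => by
          rw [h.smul_left, map_mul, evalNegHom_evalNegHom, RingHom.id_apply, smul_eq_mul] }
    exact ⟨z, fun y => by rw [hz]; rfl⟩
  choose u hu using hex
  have hext : ∀ x y, (∀ z, h.B x z = h.B y z) → x = y := fun x y hxy =>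
    sub_eq_zero.mp (h.injective _ fun z => by
      rw [map_sub, LinearMap.sub_apply, hxy, sub_self])
  refine ⟨⟨⟨u, fun x y => hext _ _ fun z => ?_⟩, fun S x => hext _ _ fun z => ?_⟩, hu,
    fun x => hext _ _ fun z => ?_, fun x hx => ?_⟩
  · rw [map_add, LinearMap.add_apply, hu, hu, hu, map_add, map_add]
  · rw [h.smul_left, hu, hu, h.smul_right, map_mul, RingHom.id_apply]
  · change h.B (u (a x)) z = h.B (a (u x)) z
    have h1 := h.a_right (u x) z
    rw [hu, hu] at h1
    rw [hu, h.a_right, map_add, map_mul, map_pow, evalNegHom_X, h1, derivative_evalNegHom]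
    ring
  · have h0 : ∀ y, h.B y x = 0 := fun y => by
      refine evalNegHom_injective ?_
      rw [← hu, map_zero]
      change u x = 0 at hx
      rw [hx, map_zero, LinearMap.zero_apply]
    refine (Module.forall_dual_apply_eq_zero_iff ℂ⟦X⟧ x).mp fun φ => ?_
    obtain ⟨y, rfl⟩ := h.surjective φ
    exact h0 y

end ABForm

end Form

/-! ### Eigenvectors in regular modules -/

section Existence

variable {N : Type u} [AddCommGroup N] [Module ℂ⟦X⟧ N]

/-- A finite free `ℂ⟦b⟧`-module is `b`-adically complete. -/
theorem exists_limit [Module.Free ℂ⟦X⟧ N] [Module.Finite ℂ⟦X⟧ N] (x : ℕ → N)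
    (hx : ∀ j, ∃ z, x (j + 1) = x j + (X ^ (j + 1) : ℂ⟦X⟧) • z) :
    ∃ y, ∀ j, ∃ z, y = x j + (X ^ (j + 1) : ℂ⟦X⟧) • z := by
  let β := Module.Free.chooseBasis ℂ⟦X⟧ N
  have hcauchy : ∀ j d, ∃ z, x (j + d) = x j + (X ^ (j + 1) : ℂ⟦X⟧) • z := by
    intro j d
    induction d with
    | zero => exact ⟨0, by rw [smul_zero, add_zero, add_zero]⟩
    | succ d ih =>
      obtain ⟨z, hz⟩ := ih
      obtain ⟨z', hz'⟩ := hx (j + d)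
      refine ⟨z + (X ^ d : ℂ⟦X⟧) • z', ?_⟩
      rw [← add_assoc, hz', hz, smul_add, smul_smul, ← pow_add, add_assoc,
        show j + d + 1 = j + 1 + d by omega]
  let y := β.equivFun.symm fun i => PowerSeries.mk fun k => coeff k (β.equivFun (x k) i)
  refine ⟨y, fun j => ?_⟩
  have hdvd : ∀ i, (X ^ (j + 1) : ℂ⟦X⟧) ∣ β.equivFun (y - x j) i := by
    intro i
    rw [X_pow_dvd_iff]
    intro k hk
    obtain ⟨d, rfl⟩ := Nat.exists_eq_add_of_le (Nat.lt_succ_iff.mp hk)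
    obtain ⟨z, hz⟩ := hcauchy k d
    rw [map_sub, Pi.sub_apply, map_sub, hz, LinearEquiv.apply_symm_apply, coeff_mk, map_add,
      map_smul, Pi.add_apply, map_add, Pi.smul_apply, smul_eq_mul,
      X_pow_dvd_iff.mp (Dvd.intro _ rfl) k k.lt_succ_self, add_zero, sub_self]
  choose z hz using hdvd
  refine ⟨β.equivFun.symm z, ?_⟩
  rw [← sub_eq_iff_eq_add', ← β.equivFun.injective.eq_iff, map_smul,
    LinearEquiv.apply_symm_apply]
  exact funext hz

/-- If `a N ⊆ b N`, there is an eigenvector: for an eigenvalue `l` of `b⁻¹ a` on `N / b N` of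
minimal real part, no `l - k` with `k ≥ 1` is an eigenvalue, so that `b⁻¹ a - l` is bijective
on `b ^ k N / b ^ (k + 1) N` and an eigenvector modulo `b` can be corrected step by step. -/
theorem exists_eigen_of_simple_pole [ABStructure N] [Module.Free ℂ⟦X⟧ N] [Module.Finite ℂ⟦X⟧ N]
    [Nontrivial N] (h : ∀ x : N, ∃ y : N, a x = (X : ℂ⟦X⟧) • y) :
    ∃ (l : ℂ) (x : N), x ≠ 0 ∧ IsABEigen l x := by
  choose θ hθ using h
  have hθ_add : ∀ x y, θ (x + y) = θ x + θ y := fun x y => X_smul_injective (by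
    rw [← hθ, map_add, smul_add, hθ, hθ])
  have hθ_C : ∀ (c : ℂ) x, θ ((C c : ℂ⟦X⟧) • x) = (C c : ℂ⟦X⟧) • θ x := fun c x =>
    X_smul_injective (by rw [← hθ, a_const_smul, smul_comm, hθ])
  have hθ_pow : ∀ (k : ℕ) x, θ ((X ^ k : ℂ⟦X⟧) • x)
      = (X ^ k : ℂ⟦X⟧) • (θ x + (C (k : ℂ) : ℂ⟦X⟧) • x) := fun k x => X_smul_injective (by
    rw [← hθ, a_X_pow_smul, hθ, smul_add, smul_add, smul_comm X, smul_smul _ _ x,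
      smul_smul _ _ x]
    congr 2
    ring)
  let β := Module.Free.chooseBasis ℂ⟦X⟧ N
  let ι := Module.Free.ChooseBasisIndex ℂ⟦X⟧ N
  -- `π` is the reduction modulo `b`, and `σ` a section of it.
  let π : N →+ (ι → ℂ) :=
    { toFun := fun x i => constantCoeff (β.equivFun x i)
      map_zero' := by ext; simp
      map_add' := fun x y => by ext; simp }
  let σ : (ι → ℂ) →+ N :=
    { toFun := fun v => β.equivFun.symm fun i => C (v i)
      map_zero' := by
        rw [← β.equivFun.injective.eq_iff, LinearEquiv.apply_symm_apply]
        ext; simp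
      map_add' := fun v w => by
        rw [← map_add]
        congr 1
        ext; simp }
  have hπC : ∀ (c : ℂ) x, π ((C c : ℂ⟦X⟧) • x) = c • π x := fun c x => funext fun i => by
    change constantCoeff (β.equivFun ((C c : ℂ⟦X⟧) • x) i) = c * constantCoeff (β.equivFun x i)
    rw [map_smul, Pi.smul_apply, smul_eq_mul, map_mul, constantCoeff_C]
  have hπX : ∀ x, π ((X : ℂ⟦X⟧) • x) = 0 := fun x => funext fun i => by
    change constantCoeff (β.equivFun ((X : ℂ⟦X⟧) • x) i) = 0
    rw [map_smul, Pi.smul_apply, smul_eq_mul, map_mul, constantCoeff_X, zero_mul]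
  have hσC : ∀ (c : ℂ) v, σ (c • v) = (C c : ℂ⟦X⟧) • σ v := fun c v => by
    change β.equivFun.symm _ = _ • β.equivFun.symm _
    rw [← map_smul]
    congr 1
    ext i : 1
    rw [Pi.smul_apply, Pi.smul_apply, smul_eq_mul, smul_eq_mul, map_mul]
  have hπσ : ∀ v, π (σ v) = v := fun v => funext fun i => by
    change constantCoeff (β.equivFun (β.equivFun.symm _) i) = _
    rw [LinearEquiv.apply_symm_apply, constantCoeff_C]
  have hker : ∀ x, π x = 0 → ∃ y, x = (X : ℂ⟦X⟧) • y := by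
    intro x hx
    have : ∀ i, ∃ S : ℂ⟦X⟧, β.equivFun x i = X * S := fun i =>
      X_dvd_iff.mpr (congrFun hx i)
    choose S hS using this
    refine ⟨β.equivFun.symm S, ?_⟩
    rw [← map_smul, LinearEquiv.eq_symm_apply]
    exact funext hS
  let A : Module.End ℂ (ι → ℂ) :=
    { toFun := fun v => π (θ (σ v))
      map_add' := fun v w => by rw [map_add, hθ_add, map_add]
      map_smul' := fun c v => by rw [hσC, hθ_C, hπC, RingHom.id_apply] }
  have hA : ∀ x, π (θ x) = A (π x) := by
    intro x
    obtain ⟨y, hy⟩ := hker (x - σ (π x)) (by rw [map_sub, hπσ, sub_self])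
    have hx : x = σ (π x) + (X ^ 1 : ℂ⟦X⟧) • y := by rw [pow_one, ← hy]; abel
    conv_lhs => rw [hx]
    rw [hθ_add, hθ_pow, pow_one, map_add, hπX, add_zero]
    rfl
  have : Nonempty ι := Module.Free.instNonemptyChooseBasisIndexOfNontrivial ℂ⟦X⟧ N
  obtain ⟨l, hl, hmin⟩ : ∃ l, A.HasEigenvalue l ∧
      ∀ m, A.HasEigenvalue m → l.re ≤ m.re := by
    obtain ⟨l₀, hl₀⟩ := Module.End.exists_eigenvalue A
    exact Set.exists_min_image {m | A.HasEigenvalue m} Complex.re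
      (Module.End.finite_hasEigenvalue A) ⟨l₀, hl₀⟩
  have hsurj : ∀ (k : ℕ) (w : ι → ℂ), ∃ z, A z + (k + 1 : ℂ) • z - l • z = w := by
    intro k
    have hinj : Function.Injective (A - algebraMap ℂ (Module.End ℂ (ι → ℂ)) (l - (k + 1))) := by
      rw [← LinearMap.ker_eq_bot, LinearMap.ker_eq_bot']
      intro z hz
      by_contra hz0
      have : A.HasEigenvalue (l - (k + 1)) :=
        Module.End.hasEigenvalue_of_hasEigenvector (x := z)
          ⟨Module.End.mem_eigenspace_iff.mpr (sub_eq_zero.mp hz), hz0⟩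
      have := hmin _ this
      simp only [Complex.sub_re, Complex.add_re, Complex.natCast_re, Complex.one_re] at this
      linarith [(k.cast_nonneg : (0 : ℝ) ≤ k)]
    intro w
    obtain ⟨z, hz⟩ := LinearMap.injective_iff_surjective.mp hinj w
    refine ⟨z, ?_⟩
    rw [← hz]
    change _ = A z - (l - (k + 1)) • z
    module
  obtain ⟨v, hv⟩ := hl.exists_hasEigenvector
  let P : ℕ → N → Prop := fun j x => ∃ w, θ x - (C l : ℂ⟦X⟧) • x = (X ^ (j + 1) : ℂ⟦X⟧) • w
  have hstart : P 0 (σ v) := by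
    obtain ⟨w, hw⟩ := hker (θ (σ v) - (C l : ℂ⟦X⟧) • σ v) (by
      rw [map_sub, hA, hπC, hπσ, hv.apply_eq_smul, sub_self])
    exact ⟨w, by rw [zero_add, pow_one, hw]⟩
  have hstep : ∀ j x, P j x → ∃ z, P (j + 1) (x + (X ^ (j + 1) : ℂ⟦X⟧) • z) := by
    rintro j x ⟨w, hw⟩
    obtain ⟨z, hz⟩ := hsurj j (-π w)
    obtain ⟨w', hw'⟩ := hker (w + (θ (σ z) + (C ((j + 1 : ℕ) : ℂ) : ℂ⟦X⟧) • σ z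
      - (C l : ℂ⟦X⟧) • σ z)) (by
        rw [map_add, map_sub, map_add, hA, hπC, hπC, hπσ, Nat.cast_succ, hz, add_neg_cancel])
    refine ⟨σ z, w', ?_⟩
    rw [pow_succ _ (j + 1), mul_smul, ← hw', smul_add (X ^ (j + 1) : ℂ⟦X⟧) w, ← hw, hθ_add,
      hθ_pow]
    rw [smul_add (C l : ℂ⟦X⟧), smul_comm (C l : ℂ⟦X⟧) (X ^ (j + 1) : ℂ⟦X⟧), smul_sub,
      add_sub_add_comm]
  choose next hnext using hstep
  let f : ∀ j, {x // P j x} := fun j => Nat.rec ⟨σ v, hstart⟩ (fun j x => ⟨_, hnext j x.1 x.2⟩) j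
  obtain ⟨y, hy⟩ := exists_limit (fun j => (f j).1) fun j => ⟨next j (f j).1 (f j).2, rfl⟩
  refine ⟨l, y, fun hy0 => ?_, ?_⟩
  · obtain ⟨z, hz⟩ := hy 0
    have := congrArg π hz
    rw [zero_add, pow_one, map_add, hπX, add_zero, hy0, map_zero] at this
    exact hv.2 (by rw [← hπσ v]; exact this.symm)
  · have hT : θ y - (C l : ℂ⟦X⟧) • y = 0 := by
      refine eq_zero_of_forall_X_pow_smul fun k => ?_
      obtain ⟨z, hz⟩ := hy k
      obtain ⟨w, hw⟩ := (f k).2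
      refine ⟨(X : ℂ⟦X⟧) • (w + θ z + (C ((k + 1 : ℕ) : ℂ) : ℂ⟦X⟧) • z - (C l : ℂ⟦X⟧) • z), ?_⟩
      rw [smul_smul, ← pow_succ, smul_sub, smul_add, smul_add, ← hw, hz, hθ_add, hθ_pow]
      simp only [smul_add, smul_comm (C l : ℂ⟦X⟧) (X ^ (k + 1) : ℂ⟦X⟧)]
      abel
    rw [IsABEigen, hθ, sub_eq_zero.mp hT, smul_smul, mul_comm]

variable [ABStructure N]

/-- A nonzero regular module contains an eigenvector. -/
theorem ABRegular.exists_eigen [Nontrivial N] (hN : ABRegular N) :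
    ∃ (l : ℂ) (x : N), x ≠ 0 ∧ IsABEigen l x := by
  obtain ⟨E', _, _, _, h, g, hg, hga⟩ := hN
  -- The saturation `L` of `N` in `E'` satisfies `a L ⊆ b L`.
  let L : ABSubmodule E' := .saturation g hga
  have hle : ∀ x, g x ∈ L.toSubmodule := fun x => ⟨0, x, by rw [pow_zero, one_smul]⟩
  have : Nontrivial L.toSubmodule := by
    obtain ⟨x, hx⟩ := exists_ne (0 : N)
    refine ⟨⟨⟨g x, hle x⟩, 0, fun h0 => hx (hg ?_)⟩⟩
    rw [map_zero]
    exact congrArg Subtype.val h0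
  obtain ⟨l, ⟨y, k, x, hx⟩, hy0, hy⟩ := exists_eigen_of_simple_pole (N := L.toSubmodule) (by
    rintro ⟨x, hx⟩
    obtain ⟨y, hy⟩ := h x
    have hyL : y ∈ L.toSubmodule := ABSubmodule.mem_saturation_of_X_smul (hy ▸ L.a_mem x hx)
    exact ⟨⟨y, hyL⟩, Subtype.ext hy⟩)
  have hy' : IsABEigen l y := congrArg Subtype.val hy
  refine ⟨l + k, x, fun hx0 => hy0 (Subtype.ext (X_pow_smul_injective k ?_)), hg ?_⟩
  · change (X ^ k : ℂ⟦X⟧) • y = _ • (0 : E')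
    rw [← hx, hx0, map_zero, smul_zero]
  · rw [hga, map_smul, hx]
    exact hy'.X_pow_smul k

/-- A nonzero `a`-stable submodule of a regular module contains an eigenvector. -/
theorem ABRegular.exists_eigen_mem (hN : ABRegular N) (G : ABSubmodule N)
    (hG : ∃ x ∈ G.toSubmodule, x ≠ 0) :
    ∃ (l : ℂ) (x : N), x ∈ G.toSubmodule ∧ x ≠ 0 ∧ IsABEigen l x := by
  have : Nontrivial G.toSubmodule := by
    obtain ⟨x, hx, hx0⟩ := hG
    exact ⟨⟨⟨x, hx⟩, 0, fun h => hx0 (congrArg Subtype.val h)⟩⟩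
  obtain ⟨l, x, hx0, hx⟩ := (hN.of_injective G.toSubmodule.subtype (fun _ => rfl)
    G.toSubmodule.subtype_injective).exists_eigen
  exact ⟨l, x, x.2, fun h => hx0 (Subtype.ext h), congrArg Subtype.val hx⟩

end Existence

/-! ### Isotropic eigenvectors -/

section CommonEigen

variable {E : Type u} [AddCommGroup E] [Module ℂ⟦X⟧ E] [ABStructure E]
  [Module.Free ℂ⟦X⟧ E]

/-- Eigenvectors of the same parameter which are linearly independent over `ℂ` are so over
`ℂ⟦b⟧`. -/
theorem coeff_eq_zero_of_sum_smul_eq_zero {ι : Type*} {l : ℂ} {x : ι → E}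
    (hx : ∀ i, IsABEigen l (x i)) (s : Finset ι)
    (hli : ∀ c : ι → ℂ, ∑ i ∈ s, (C (c i) : ℂ⟦X⟧) • x i = 0 → ∀ i ∈ s, c i = 0) (k : ℕ)
    (S : ι → ℂ⟦X⟧) (hS : ∑ i ∈ s, S i • x i = 0) : ∀ i ∈ s, coeff k (S i) = 0 := by
  have h0 := hli _ (sum_constantCoeff_smul_eq_zero s (fun i _ => hx i) hS)
  induction k generalizing S with
  | zero => simpa using h0
  | succ k ih =>
    have hT : ∀ i ∈ s, S i = X * PowerSeries.mk fun p => coeff (p + 1) (S i) := fun i hi => by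
      conv_lhs => rw [(S i).eq_X_mul_shift_add_const, h0 i hi, map_zero, add_zero]
    have hT' : ∑ i ∈ s, (PowerSeries.mk fun p => coeff (p + 1) (S i) : ℂ⟦X⟧) • x i = 0 := by
      refine X_smul_injective ?_
      rw [smul_zero, Finset.smul_sum, ← hS]
      refine Finset.sum_congr rfl fun i hi => ?_
      rw [smul_smul, ← hT i hi]
    intro i hi
    have := ih _ hT' (hli _ (sum_constantCoeff_smul_eq_zero s (fun i _ => hx i) hT')) i hi
    rwa [coeff_mk] at this

/-- An endomorphism which preserves a nonzero `ℂ`-subspace of the eigenvectors of given parameter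
has an eigenvector there, because this subspace has finite dimension. -/
theorem exists_eigenvector_mem [Module.Finite ℂ⟦X⟧ E] {l : ℂ} (P : AddSubgroup E)
    (hPC : ∀ (c : ℂ), ∀ x ∈ P, (C c : ℂ⟦X⟧) • x ∈ P) (hPl : ∀ x ∈ P, IsABEigen l x)
    (f : E →ₗ[ℂ⟦X⟧] E) (hf : ∀ x ∈ P, f x ∈ P) (hP : ∃ x ∈ P, x ≠ 0) :
    ∃ c : ℂ, ∃ x ∈ P, x ≠ 0 ∧ f x = (C c : ℂ⟦X⟧) • x := by
  let _ : Module ℂ E := Module.compHom E (C : ℂ →+* ℂ⟦X⟧)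
  let W : Submodule ℂ E := { P with smul_mem' := hPC }
  let b := Module.Basis.ofVectorSpace ℂ W
  have hli : LinearIndependent ℂ⟦X⟧ fun i => (b i : E) := by
    rw [linearIndependent_iff']
    intro s S hS i hi
    ext k
    refine coeff_eq_zero_of_sum_smul_eq_zero (fun i => hPl _ (b i).2) s (fun c hc => ?_) k S hS i hi
    refine linearIndependent_iff'.mp b.linearIndependent s c (Subtype.ext ?_)
    rw [AddSubmonoidClass.coe_finsetSum]
    exact hc
  have : Finite (Module.Basis.ofVectorSpaceIndex ℂ W) := hli.finite
  have : Module.Finite ℂ W := Module.Finite.of_basis b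
  have : Nontrivial W := by
    obtain ⟨x, hx, hx0⟩ := hP
    exact ⟨⟨⟨x, hx⟩, 0, fun h => hx0 (congrArg Subtype.val h)⟩⟩
  let g : Module.End ℂ W :=
    { toFun := fun x => ⟨f x, hf x x.2⟩
      map_add' := fun x y => Subtype.ext (f.map_add x y)
      map_smul' := fun c x => Subtype.ext (f.map_smul (C c) x) }
  obtain ⟨c, hc⟩ := Module.End.exists_eigenvalue g
  obtain ⟨x, hx⟩ := hc.exists_hasEigenvector
  exact ⟨c, x, x.2, fun h => hx.2 (Subtype.ext h), congrArg Subtype.val hx.apply_eq_smul⟩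

end CommonEigen

theorem eq_of_X_pow_mul_isUnit_eq {j k : ℕ} {U V : ℂ⟦X⟧} (hU : IsUnit U) (hV : IsUnit V)
    (h : X ^ j * U = X ^ k * V) : j = k := by
  have hX : ¬ IsUnit (X : ℂ⟦X⟧) := X_prime.not_isUnit
  apply le_antisymm
  · rw [← pow_dvd_pow_iff X_ne_zero hX, ← hV.dvd_mul_right, ← h]
    exact Dvd.intro _ rfl
  · rw [← pow_dvd_pow_iff X_ne_zero hX, ← hU.dvd_mul_right, h]
    exact Dvd.intro _ rfl

namespace ABForm

variable {E : Type u} [AddCommGroup E] [Module ℂ⟦X⟧ E] [ABStructure E] (h : ABForm E)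

/-- The orthogonal of an eigenvector. -/
noncomputable def perp {l : ℂ} {e : E} (he : IsABEigen l e) : ABSubmodule E where
  toSubmodule := LinearMap.ker (h.B e)
  a_mem y hy := by
    rw [LinearMap.mem_ker] at hy ⊢
    rw [h.a_right, he, h.smul_left, hy, mul_zero, map_zero, mul_zero, add_zero]

theorem mem_perp {l : ℂ} {e : E} (he : IsABEigen l e) {y : E} :
    y ∈ (h.perp he).toSubmodule ↔ h.B e y = 0 := LinearMap.mem_ker

variable [Module.Free ℂ⟦X⟧ E] [Module.Finite ℂ⟦X⟧ E]

/-- The Gram determinant of a family with as many members as the rank has even `b`-adic valuation: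
it is `P(-b) det(H) P(b)` where `P` is the determinant of the coordinates of the family, and the
Gram matrix `H` of a basis is invertible. -/
theorem exists_even_order_of_gram {n : ℕ} (hn : Module.finrank ℂ⟦X⟧ E = n) (e : Fin n → E)
    (hdet : (Matrix.of fun i j => h.B (e i) (e j)).det ≠ 0) :
    ∃ (m : ℕ) (U : ℂ⟦X⟧), IsUnit U ∧
      (Matrix.of fun i j => h.B (e i) (e j)).det = X ^ (2 * m) * U := by
  let β := Module.finBasisOfFinrankEq ℂ⟦X⟧ E hn
  let H : Matrix (Fin n) (Fin n) ℂ⟦X⟧ := .of fun i j => h.B (β i) (β j)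
  have hgram : ∀ x y : Fin n → E, (Matrix.of fun i j => h.B (x i) (y j)) =
      (Matrix.of fun i j => evalNegHom (β.repr (x i) j)) * H *
        (Matrix.of fun i j => β.repr (y i) j).transpose := by
    intro x y
    ext1 i j
    rw [Matrix.mul_apply, Matrix.of_apply]
    conv_lhs => rw [← β.sum_repr (x i), ← β.sum_repr (y j)]
    simp only [map_sum, LinearMap.sum_apply, h.smul_left, h.smul_right, Matrix.mul_apply,
      Matrix.of_apply, Matrix.transpose_apply, Finset.sum_mul, H]
    exact Finset.sum_congr rfl fun k _ => Finset.sum_congr rfl fun l _ => by ring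
  choose y hy using fun k => h.surjective (β.coord k)
  have hH : IsUnit H.det := by
    have h1 : (Matrix.of fun i j => h.B (y i) (β j)) = 1 := by
      ext1 i j
      rw [Matrix.of_apply, hy, Module.Basis.coord_apply, Module.Basis.repr_self,
        Finsupp.single_apply, Matrix.one_apply]
      simp only [eq_comm]
    have h2 := congrArg Matrix.det (hgram y β)
    rw [h1, Matrix.det_one, Matrix.det_mul, Matrix.det_mul] at h2
    exact isUnit_of_mul_isUnit_right (isUnit_of_mul_isUnit_left (h2 ▸ isUnit_one))
  let p : ℂ⟦X⟧ := (Matrix.of fun i j => β.repr (e i) j).det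
  have hp : (Matrix.of fun i j => h.B (e i) (e j)).det = evalNegHom p * H.det * p := by
    rw [hgram e e, Matrix.det_mul, Matrix.det_mul, Matrix.det_transpose, RingHom.map_det]
    rfl
  have hp0 : p ≠ 0 := fun h0 => hdet (by rw [hp, h0, mul_zero])
  obtain ⟨m, V, hV, hpV⟩ := exists_X_pow_mul_isUnit hp0
  refine ⟨m, (-1) ^ m * evalNegHom V * H.det * V, ?_, ?_⟩
  · exact (((isUnit_one.neg.pow m).mul (hV.map evalNegHom)).mul hH).mul hV
  · rw [hp, hpV, map_mul, map_pow, evalNegHom_X, neg_pow X m]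
    ring

variable {u : E →ₗ[ℂ⟦X⟧] E}

/-- If the eigenvectors of parameter `l` span at least a plane, some eigenvector of the asymmetry
among them is isotropic. The form takes its values on them in `ℂ b ^ k`, and an anisotropic
eigenvector of the asymmetry has the eigenvalue `(-1) ^ k`. If the asymmetry is not scalar,
an eigenvector in the image of `u - (-1) ^ k` is isotropic; if it is, the form is
symmetric and represents zero. -/
theorem exists_isotropic_of_two (hu : ∀ x y, h.B (u x) y = evalNegHom (h.B y x))
    (hua : ∀ x, u (a x) = a (u x)) {l : ℂ} {x y : E} (hx : IsABEigen l x)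
    (hy : IsABEigen l y)
    (hxy : ∀ c d : ℂ, (C c : ℂ⟦X⟧) • x + (C d : ℂ⟦X⟧) • y = 0 → c = 0 ∧ d = 0) :
    ∃ (v : E) (c : ℂ), v ≠ 0 ∧ IsABEigen l v ∧ u v = (C c : ℂ⟦X⟧) • v ∧ h.B v v = 0 := by
  by_contra! hbad
  have hul : ∀ z, IsABEigen l z → IsABEigen l (u z) := fun z hz => by
    rw [IsABEigen, ← hua, hz, map_smul]
  have hx0 : x ≠ 0 := fun h0 => by simpa using hxy 1 0 (by simp [h0])
  have hy0 : y ≠ 0 := fun h0 => by simpa using hxy 0 1 (by simp [h0])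
  let W : AddSubgroup E :=
    { carrier := {z | IsABEigen l z}
      zero_mem' := by rw [Set.mem_ofPred_eq, IsABEigen, map_zero, smul_zero]
      add_mem' := fun hz hw => hz.add hw
      neg_mem' := fun {z} hz => by
        have := hz.C_smul (-1)
        rwa [map_neg, map_one, neg_one_smul] at this }
  obtain ⟨k, hk⟩ : ∃ k : ℕ, l + l = k := by
    by_contra! hk
    obtain ⟨c, v, hv, hv0, hcv⟩ := exists_eigenvector_mem W (fun c z hz => hz.C_smul c)
      (fun _ hz => hz) u hul ⟨x, hx, hx0⟩
    exact hbad v c hv0 hv hcv (h.eq_zero_of_forall_ne hv hv hk)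
  have hB : ∀ z w, IsABEigen l z → IsABEigen l w → coeff k (h.B z w) = 0 → h.B z w = 0 :=
    fun z w hz hw h0 => by rw [h.eq_monomial hz hw hk, h0, map_zero, zero_mul]
  let ε : ℂ := (-1) ^ k
  have hε : ε ≠ 0 := pow_ne_zero k (by norm_num)
  have huβ : ∀ z w, coeff k (h.B (u z) w) = ε * coeff k (h.B w z) := fun z w => by
    rw [hu, coeff_evalNegHom]
  have heig : ∀ (v : E) (c : ℂ), v ≠ 0 → IsABEigen l v → u v = (C c : ℂ⟦X⟧) • v → c = ε := by
    intro v c hv0 hv hcv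
    have h1 := huβ v v
    rw [hcv, h.C_smul_left, coeff_C_mul] at h1
    exact mul_right_cancel₀ (fun h0 => hbad v c hv0 hv hcv (hB v v hv hv h0)) h1
  have hscalar : ∀ z, IsABEigen l z → u z = (C ε : ℂ⟦X⟧) • z := by
    intro z hz
    by_contra hne
    let g : E →ₗ[ℂ⟦X⟧] E := u - (C ε : ℂ⟦X⟧) • LinearMap.id
    have hg : ∀ w, g w = u w - (C ε : ℂ⟦X⟧) • w := fun _ => rfl
    have hgW : ∀ w ∈ W, g w ∈ W := fun w hw => W.sub_mem (hul w hw) (hw.C_smul ε)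
    obtain ⟨c, v, ⟨w, hw, rfl⟩, hv0, hcv⟩ := exists_eigenvector_mem (l := l)
      (W.map g.toAddMonoidHom)
      (by
        rintro c _ ⟨w, hw, rfl⟩
        exact ⟨(C c : ℂ⟦X⟧) • w, hw.C_smul c, g.map_smul _ _⟩)
      (by
        rintro _ ⟨w, hw, rfl⟩
        exact hgW w hw) u
      (by
        rintro _ ⟨w, hw, rfl⟩
        refine ⟨u w, hul w hw, ?_⟩
        change g (u w) = u (g w)
        rw [hg, hg, map_sub, map_smul])
      ⟨g z, ⟨z, hz, rfl⟩, by rw [hg]; exact sub_ne_zero.mpr hne⟩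
    change g w ≠ 0 at hv0
    change u (g w) = (C c : ℂ⟦X⟧) • g w at hcv
    have hgw : IsABEigen l (g w) := hgW w hw
    obtain rfl := heig _ c hv0 hgw hcv
    refine hbad (g w) ε hv0 hgw hcv (hB _ _ hgw hgw ?_)
    have h1 := huβ (g w) w
    rw [hcv, h.C_smul_left, coeff_C_mul] at h1
    have h2 : ∀ v, coeff k (h.B (g w) v) = coeff k (h.B (u w) v) - ε * coeff k (h.B w v) :=
      fun v => by rw [hg w, map_sub, LinearMap.sub_apply, h.C_smul_left, map_sub, coeff_C_mul]
    rw [h2, huβ, h1, sub_self]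
  have hsymm : coeff k (h.B x y) = coeff k (h.B y x) := by
    have h1 := huβ x y
    rw [hscalar x hx, h.C_smul_left, coeff_C_mul] at h1
    exact mul_left_cancel₀ hε h1
  have hyy : coeff k (h.B y y) ≠ 0 := fun h0 =>
    hbad y ε hy0 hy (hscalar y hy) (hB y y hy hy h0)
  obtain ⟨t, ht⟩ := exists_quadratic_eq_zero (b := 2 * coeff k (h.B x y))
    (c := coeff k (h.B x x)) hyy (IsAlgClosed.exists_eq_mul_self _)
  have hv : IsABEigen l (x + (C t : ℂ⟦X⟧) • y) := hx.add (hy.C_smul t)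
  refine hbad _ ε (fun h0 => ?_) hv (hscalar _ hv) (hB _ _ hv hv ?_)
  · exact one_ne_zero (hxy 1 t (by rwa [map_one, one_smul])).1
  · simp only [map_add, LinearMap.add_apply, h.C_smul_left, h.smul_right, coeff_C_mul]
    rw [← ht, hsymm]
    ring

/-- In rank at least two some eigenvector of the asymmetry is an isotropic eigenvector for `a`.
Otherwise the eigenspaces have dimension at most one and all parameters are half-integers; two
orthogonal eigenvectors cannot have parameters in the same class modulo the integers, because
multiplying one of them by a power of `b` would bring them into the same eigenspace. This bounds the
rank by two, and in rank two the Gram determinant would have odd valuation. -/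
theorem exists_isotropic (hreg : ABRegular E) (hn : 2 ≤ Module.finrank ℂ⟦X⟧ E)
    (hu : ∀ x y, h.B (u x) y = evalNegHom (h.B y x)) (hua : ∀ x, u (a x) = a (u x)) :
    ∃ (l : ℂ) (v : E) (c : ℂ), v ≠ 0 ∧ IsABEigen l v ∧ u v = (C c : ℂ⟦X⟧) • v ∧
      h.B v v = 0 := by
  by_contra! hbad
  have hul : ∀ l z, IsABEigen l z → IsABEigen l (u z) := fun l z hz => by
    rw [IsABEigen, ← hua, hz, map_smul]
  have hC : ∀ (c : ℂ), c ≠ 0 → (C c : ℂ⟦X⟧) ≠ 0 := fun c hc h0 =>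
    hc (C_injective (h0.trans (map_zero _).symm))
  -- All eigenspaces have dimension at most one.
  have hdim : ∀ (l : ℂ) (x y : E), x ≠ 0 → IsABEigen l x → IsABEigen l y →
      ∃ t : ℂ, y = (C t : ℂ⟦X⟧) • x := by
    intro l x y hx0 hx hy
    by_contra! hne
    obtain ⟨v, c, hv0, hv, hc, hvv⟩ := h.exists_isotropic_of_two hu hua hx hy (by
      intro c d hcd
      have hd : d = 0 := by
        by_contra hd
        refine hne (-(d⁻¹ * c)) ?_
        refine smul_right_injective E (hC d hd) ?_
        change (C d : ℂ⟦X⟧) • y = (C d : ℂ⟦X⟧) • _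
        rw [smul_smul, ← map_mul, mul_neg, mul_inv_cancel_left₀ hd, map_neg, neg_smul,
          eq_neg_iff_add_eq_zero, add_comm]
        exact hcd
      rw [hd, map_zero, zero_smul, add_zero] at hcd
      refine ⟨?_, hd⟩
      by_contra hc
      exact (smul_ne_zero (hC c hc) hx0) hcd)
    exact hbad l v c hv0 hv hc hvv
  have hne : ∀ (l : ℂ) (x : E), x ≠ 0 → IsABEigen l x → h.B x x ≠ 0 := by
    intro l x hx0 hx
    obtain ⟨c, hc⟩ := hdim l x (u x) hx0 hx (hul l x hx)
    exact hbad l x c hx0 hx hc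
  have hint : ∀ (l : ℂ) (x : E), x ≠ 0 → IsABEigen l x → ∃ k : ℕ, l + l = k := by
    intro l x hx0 hx
    by_contra! hk
    exact hne l x hx0 hx (h.eq_zero_of_forall_ne hx hx hk)
  -- For orthogonal eigenvectors, the difference of the parameters is not an integer.
  have hpar : ∀ (l m : ℂ) (x y : E) (j k : ℕ), x ≠ 0 → y ≠ 0 → IsABEigen l x → IsABEigen m y →
      h.B x y = 0 → l + l = j → m + m = k → (j + k) % 2 = 1 := by
    intro l m x y j k hx0 hy0 hx hy hxy hj hk
    by_contra hodd
    have hx' : ∀ d : ℕ, (X ^ d : ℂ⟦X⟧) • x ≠ 0 := fun d =>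
      smul_ne_zero (pow_ne_zero d X_ne_zero) hx0
    rcases le_total j k with hjk | hjk
    · obtain ⟨d, rfl⟩ : ∃ d, k = j + 2 * d := ⟨(k - j) / 2, by omega⟩
      have hm : l + d = m := by
        push_cast at hk
        linear_combination (hj - hk) / 2
      obtain ⟨t, ht⟩ := hdim m _ y (hx' d) (hm ▸ hx.X_pow_smul d) hy
      rw [ht, h.smul_right, h.smul_right] at hxy
      rcases mul_eq_zero.mp hxy with h0 | h0
      · exact hy0 (by rw [ht, h0, zero_smul])
      · exact (mul_ne_zero (pow_ne_zero d X_ne_zero) (hne l x hx0 hx)) h0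
    · obtain ⟨d, rfl⟩ : ∃ d, j = k + 2 * d := ⟨(j - k) / 2, by omega⟩
      have hm : m + d = l := by
        push_cast at hj
        linear_combination (hk - hj) / 2
      obtain ⟨t, ht⟩ := hdim l x _ hx0 hx (hm ▸ hy.X_pow_smul d)
      have h1 := h.smul_right (X ^ d) x y
      rw [ht, h.smul_right, hxy, mul_zero] at h1
      rcases mul_eq_zero.mp h1 with h0 | h0
      · rw [h0, zero_smul] at ht
        exact (smul_ne_zero (pow_ne_zero d X_ne_zero) hy0) ht
      · exact hne l x hx0 hx h0
  have : Nontrivial E := Module.nontrivial_of_finrank_pos (R := ℂ⟦X⟧) (by omega)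
  obtain ⟨l, x, hx0, hx⟩ := hreg.exists_eigen
  obtain ⟨j, hj⟩ := hint l x hx0 hx
  obtain ⟨m, y, hyx, hy0, hy⟩ := hreg.exists_eigen_mem (h.perp hx) (by
    by_contra! h0
    have := LinearMap.finrank_le_finrank_of_injective (f := h.B x)
      (LinearMap.ker_eq_bot.mp (LinearMap.ker_eq_bot'.mpr h0))
    rw [Module.finrank_self] at this
    omega)
  rw [h.mem_perp] at hyx
  obtain ⟨k, hk⟩ := hint m y hy0 hy
  have hjk := hpar l m x y j k hx0 hy0 hx hy hyx hj hk
  rcases hn.eq_or_lt with hn2 | hn3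
  · -- In rank two the Gram determinant of `x`, `y` has the odd valuation `j + k`.
    have hxy : h.B y x = 0 := by
      obtain ⟨c, hc⟩ := hdim l x (u x) hx0 hx (hul l x hx)
      refine evalNegHom_injective ?_
      rw [← hu, hc, h.smul_left, hyx, mul_zero, map_zero]
    have hdet : (Matrix.of fun i i' => h.B (![x, y] i) (![x, y] i')).det
        = X ^ (j + k) * (C (coeff j (h.B x x)) * C (coeff k (h.B y y))) := by
      rw [Matrix.det_fin_two]
      simp only [Matrix.of_apply, Matrix.cons_val_zero, Matrix.cons_val_one]
      rw [hyx, zero_mul, sub_zero]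
      conv_lhs => rw [h.eq_monomial hx hx hj, h.eq_monomial hy hy hk]
      ring
    have hunit : ∀ (i : ℕ) (S : ℂ⟦X⟧), S = C (coeff i S) * X ^ i → S ≠ 0 →
        IsUnit (C (coeff i S) : ℂ⟦X⟧) := fun i S hS hS0 =>
      (IsUnit.mk0 _ fun h0 => hS0 (by rw [hS, h0, map_zero, zero_mul])).map C
    have hUu := (hunit j _ (h.eq_monomial hx hx hj) (hne l x hx0 hx)).mul
      (hunit k _ (h.eq_monomial hy hy hk) (hne m y hy0 hy))
    obtain ⟨d, U, hU, hdet'⟩ := h.exists_even_order_of_gram hn2.symm ![x, y] (by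
      rw [hdet]
      exact mul_ne_zero (pow_ne_zero _ X_ne_zero) hUu.ne_zero)
    have := eq_of_X_pow_mul_isUnit_eq hUu hU (hdet.symm.trans hdet')
    omega
  · -- In higher rank there is a third eigenvector orthogonal to the first two.
    let G : ABSubmodule E :=
      { toSubmodule := (h.perp hx).toSubmodule ⊓ (h.perp hy).toSubmodule
        a_mem := fun z hz => ⟨(h.perp hx).a_mem z hz.1, (h.perp hy).a_mem z hz.2⟩ }
    obtain ⟨p, z, hz, hz0, hzp⟩ := hreg.exists_eigen_mem G (by
      by_contra! h0
      have := LinearMap.finrank_le_finrank_of_injective (f := (h.B x).prod (h.B y))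
        (LinearMap.ker_eq_bot.mp (LinearMap.ker_eq_bot'.mpr fun z hz =>
          h0 z ⟨congrArg Prod.fst hz, congrArg Prod.snd hz⟩))
      rw [Module.finrank_prod, Module.finrank_self] at this
      omega)
    obtain ⟨i, hi⟩ := hint p z hz0 hzp
    have h1 := hpar l p x z j i hx0 hz0 hx hzp hz.1 hj hi
    have h2 := hpar m p y z k i hy0 hz0 hy hzp hz.2 hk hi
    omega

end ABForm

/-! ### Reduction by an isotropic eigenvector -/

section Pull

variable {E : Type u} [AddCommGroup E] [Module ℂ⟦X⟧ E] [ABStructure E] {G F : ABSubmodule E}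

/-- The preimage in `E` of a submodule of the subquotient `G / F`. -/
noncomputable def ABSubmodule.pull (A : ABSubmodule (G.Quot F)) : ABSubmodule E where
  toSubmodule := (A.toSubmodule.comap (F.within G).toSubmodule.mkQ).map G.toSubmodule.subtype
  a_mem := by
    rintro _ ⟨x, hx, rfl⟩
    exact ⟨a x, A.a_mem _ hx, rfl⟩

theorem ABSubmodule.mem_pull {A : ABSubmodule (G.Quot F)} {x : E} :
    x ∈ (pull A).toSubmodule ↔ ∃ hx : x ∈ G.toSubmodule,
      (Submodule.Quotient.mk ⟨x, hx⟩ : G.Quot F) ∈ A.toSubmodule := by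
  constructor
  · rintro ⟨x, hx, rfl⟩
    exact ⟨x.2, hx⟩
  · rintro ⟨hx, hxA⟩
    exact ⟨⟨x, hx⟩, hxA, rfl⟩

theorem ABSubmodule.pull_quot_isomorphic (A B : ABSubmodule (G.Quot F)) :
    ABIsomorphic ((pull A).Quot (pull B)) (A.Quot B) := by
  have hle : (pull A).toSubmodule ≤ G.toSubmodule := fun x hx => (mem_pull.mp hx).1
  refine quot_isomorphic
    (((F.within G).toSubmodule.mkQ.comp (Submodule.inclusion hle)).codRestrict A.toSubmodule
      fun x => (mem_pull.mp x.2).2)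
    (fun x => rfl) ?_ fun x => ⟨fun hx => (mem_pull.mp hx).2, fun hx => mem_pull.mpr ⟨_, hx⟩⟩
  rintro ⟨x, hx⟩
  induction x using Submodule.Quotient.induction_on with
  | H x => exact ⟨⟨x, mem_pull.mpr ⟨x.2, hx⟩⟩, rfl⟩

end Pull

namespace ABForm

variable {E : Type u} [AddCommGroup E] [Module ℂ⟦X⟧ E] [ABStructure E] (h : ABForm E)

/-- If `B e` takes the value one, it identifies the quotient of `E` by the orthogonal of `e`
with the elementary module of the opposite parameter. -/
theorem quot_perp_isomorphic {l : ℂ} {e y₁ : E} (he : IsABEigen l e) (hy₁ : h.B e y₁ = 1)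
    {A K : ABSubmodule E} (hA : A.toSubmodule = ⊤)
    (hK : ∀ x, x ∈ K.toSubmodule ↔ h.B e x = 0) :
    ABIsomorphic (A.Quot K) (ABElementary (-l)) := by
  refine ABSubmodule.isomorphic_of_surjective (N := ABElementary (-l)) (K.within A)
    (show A.toSubmodule →ₗ[ℂ⟦X⟧] ℂ⟦X⟧ from (h.B e).comp A.toSubmodule.subtype)
    (fun x => ?_) (fun S => ⟨⟨(show ℂ⟦X⟧ from S) • y₁, hA ▸ trivial⟩, ?_⟩) fun x => hK x
  · change h.B e (a (x : E)) = C (-l) * X * h.B e x + X ^ 2 * derivative ℂ (h.B e x)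
    rw [h.a_right, he, h.smul_left, map_mul, evalNegHom_X, ABConj.evalNegHom_C, map_neg]
    ring
  · change h.B e ((show ℂ⟦X⟧ from S) • y₁) = S
    rw [h.smul_right, hy₁]
    exact mul_one (show ℂ⟦X⟧ from S)

/-- A primitive vector pairs to one with some vector, because the form is perfect. -/
theorem exists_apply_eq_one {e : E} (he : ∀ z : E, e ≠ (X : ℂ⟦X⟧) • z) : ∃ y, h.B e y = 1 := by
  obtain ⟨y, hy⟩ : ∃ y, constantCoeff (h.B e y) ≠ 0 := by
    by_contra! hall
    have hdvd : ∀ y, ∃ S : ℂ⟦X⟧, h.B e y = X * S := fun y => X_dvd_iff.mpr (hall y)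
    choose ψ hψ using hdvd
    have hX : ∀ S T : ℂ⟦X⟧, X * S = X * T → S = T := fun S T => mul_left_cancel₀ X_ne_zero
    obtain ⟨z, hz⟩ := h.surjective
      { toFun := ψ
        map_add' := fun y y' => hX _ _ (by rw [← hψ, map_add, mul_add, hψ, hψ])
        map_smul' := fun S y => hX _ _ (by
          rw [← hψ, h.smul_right, hψ, RingHom.id_apply, smul_eq_mul]; ring) }
    refine he (-z) ?_
    rw [← sub_eq_zero, smul_neg, sub_neg_eq_add]
    refine h.injective _ fun y => ?_
    rw [map_add, LinearMap.add_apply, h.smul_left, evalNegHom_X, hz, hψ]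
    change X * ψ y + -X * ψ y = 0
    ring
  obtain ⟨U, hU⟩ := isUnit_iff_constantCoeff.mpr (isUnit_iff_ne_zero.mpr hy)
  exact ⟨(↑U⁻¹ : ℂ⟦X⟧) • y, by rw [h.smul_right, ← hU, Units.inv_mul]⟩

end ABForm

/-- The submodule generated by an eigenvector. -/
noncomputable def ABSubmodule.line {E : Type u} [AddCommGroup E] [Module ℂ⟦X⟧ E] [ABStructure E]
    [Module.Free ℂ⟦X⟧ E] {l : ℂ} {e : E} (he : IsABEigen l e) : ABSubmodule E where
  toSubmodule := Submodule.span ℂ⟦X⟧ {e}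
  a_mem x hx := by
    obtain ⟨S, rfl⟩ := Submodule.mem_span_singleton.mp hx
    rw [a_smul, he, smul_smul, ← add_smul]
    exact Submodule.mem_span_singleton.mpr ⟨_, rfl⟩

theorem ABSubmodule.mem_line {E : Type u} [AddCommGroup E] [Module ℂ⟦X⟧ E] [ABStructure E]
    [Module.Free ℂ⟦X⟧ E] {l : ℂ} {e : E} {he : IsABEigen l e} {x : E} :
    x ∈ (line he).toSubmodule ↔ ∃ S : ℂ⟦X⟧, S • e = x := Submodule.mem_span_singleton

namespace ABForm

variable {E : Type u} [AddCommGroup E] [Module ℂ⟦X⟧ E] [ABStructure E] [Module.Free ℂ⟦X⟧ E]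
  (h : ABForm E) {l : ℂ} {e : E} (he : IsABEigen l e)

/-- The subquotient `e^⊥ / ⟨e⟩`. -/
abbrev Reduction : Type u := (h.perp he).Quot (ABSubmodule.line he)

variable {y₁ : E}

theorem apply_eq_zero_of_mem_line (hright : ∀ x, h.B e x = 0 ↔ h.B x e = 0)
    {x : E} (hx : x ∈ (h.perp he).toSubmodule) {y : E}
    (hy : y ∈ (ABSubmodule.line he).toSubmodule) : h.B x y = 0 := by
  obtain ⟨S, rfl⟩ := ABSubmodule.mem_line.mp hy
  rw [h.smul_right, (hright x).mp ((h.mem_perp he).mp hx), mul_zero]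

/-- If the left and right orthogonals of the isotropic vector `e` coincide and `B e` takes the value
one, the form induces a form on `e^⊥ / ⟨e⟩`. -/
theorem nonempty_form_reduction (hright : ∀ x, h.B e x = 0 ↔ h.B x e = 0)
    (hee : h.B e e = 0) (hy₁ : h.B e y₁ = 1) : Nonempty (ABForm (h.Reduction he)) := by
  let G := h.perp he
  let K := ((ABSubmodule.line he).within G).toSubmodule
  let B₁ : G.toSubmodule →ₛₗ[(evalNegHom : ℂ⟦X⟧ →+* ℂ⟦X⟧)] h.Reduction he →ₗ[ℂ⟦X⟧] ℂ⟦X⟧ :=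
    { toFun := fun x => K.liftQ ((h.B x).comp G.toSubmodule.subtype) fun y hy =>
        h.apply_eq_zero_of_mem_line he hright x.2 hy
      map_add' := fun x y => by
        refine LinearMap.ext fun z => ?_
        induction z using Submodule.Quotient.induction_on with
        | H z => exact congrArg (fun φ : E →ₗ[ℂ⟦X⟧] ℂ⟦X⟧ => φ z) (h.B.map_add x y)
      map_smul' := fun S x => by
        refine LinearMap.ext fun z => ?_
        induction z using Submodule.Quotient.induction_on with
        | H z => exact congrArg (fun φ : E →ₗ[ℂ⟦X⟧] ℂ⟦X⟧ => φ z) (h.B.map_smulₛₗ S x) }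
  let B : h.Reduction he →ₛₗ[(evalNegHom : ℂ⟦X⟧ →+* ℂ⟦X⟧)] h.Reduction he →ₗ[ℂ⟦X⟧] ℂ⟦X⟧ :=
    K.liftQ B₁ (by
      intro x hx
      refine LinearMap.mem_ker.mpr (LinearMap.ext fun z => ?_)
      induction z using Submodule.Quotient.induction_on with
      | H z =>
        obtain ⟨S, hS⟩ := (ABSubmodule.mem_line (he := he)).mp hx
        change h.B x z = 0
        change S • e = x at hS
        rw [← hS, h.smul_left, (h.mem_perp he).mp z.2, mul_zero])
  have hB : ∀ x y : G.toSubmodule,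
      B (Submodule.Quotient.mk x) (Submodule.Quotient.mk y) = h.B x y := fun _ _ => rfl
  -- The projection onto `e^⊥` along `y₁`.
  let pr : E →ₗ[ℂ⟦X⟧] G.toSubmodule :=
    (LinearMap.id - (h.B e).smulRight y₁).codRestrict G.toSubmodule fun y => by
      rw [h.mem_perp, LinearMap.sub_apply, LinearMap.id_apply, LinearMap.smulRight_apply,
        map_sub, h.smul_right, hy₁, mul_one, sub_self]
  have hpr : ∀ y, (pr y : E) = y - h.B e y • y₁ := fun _ => rfl
  have hpr' : ∀ y : G.toSubmodule, pr y = y := fun y => Subtype.ext (by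
    rw [hpr, (h.mem_perp he).mp y.2, zero_smul, sub_zero])
  refine ⟨B, fun x y => ?_, fun x hx => ?_, fun ψ => ?_⟩
  · induction x using Submodule.Quotient.induction_on with
    | H x =>
      induction y using Submodule.Quotient.induction_on with
      | H y => exact h.a_right x y
  · induction x using Submodule.Quotient.induction_on with
    | H x =>
      rw [Submodule.Quotient.mk_eq_zero, ABSubmodule.mem_within, ABSubmodule.mem_line]
      refine ⟨evalNegHom (h.B x y₁), sub_eq_zero.mp (h.injective _ fun y => ?_)⟩
      have h1 := hx (Submodule.Quotient.mk (pr y))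
      rw [hB, hpr, map_sub, h.smul_right] at h1
      rw [map_sub, LinearMap.sub_apply, h.smul_left, evalNegHom_evalNegHom]
      linear_combination -h1
  · obtain ⟨x, hx⟩ := h.surjective (ψ.comp (K.mkQ.comp pr))
    have hxG : x ∈ G.toSubmodule := by
      rw [h.mem_perp, hright, hx]
      have he' : pr e = ⟨e, (h.mem_perp he).mpr hee⟩ := hpr' ⟨e, (h.mem_perp he).mpr hee⟩
      rw [LinearMap.comp_apply, LinearMap.comp_apply, he', Submodule.mkQ_apply,
        (Submodule.Quotient.mk_eq_zero K).mpr
          ((ABSubmodule.mem_line (he := he)).mpr ⟨1, one_smul _ e⟩),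
        map_zero]
    refine ⟨Submodule.Quotient.mk ⟨x, hxG⟩, LinearMap.ext fun y => ?_⟩
    induction y using Submodule.Quotient.induction_on with
    | H y =>
      rw [hB, hx, LinearMap.comp_apply, LinearMap.comp_apply, hpr', Submodule.mkQ_apply]

theorem X_smul_mem_line {z : E} (hz : h.B z e = 1) {x : E}
    (hx : (X : ℂ⟦X⟧) • x ∈ (ABSubmodule.line he).toSubmodule) :
    x ∈ (ABSubmodule.line he).toSubmodule := by
  obtain ⟨S, hS⟩ := ABSubmodule.mem_line.mp hx
  refine ABSubmodule.mem_line.mpr ⟨h.B z x, X_smul_injective ?_⟩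
  rw [← hS, smul_smul, ← h.smul_right, ← hS, h.smul_right, hz, mul_one]

theorem finrank_reduction [Module.Finite ℂ⟦X⟧ E] (he0 : e ≠ 0) (hee : h.B e e = 0)
    (hy₁ : h.B e y₁ = 1) :
    Module.finrank ℂ⟦X⟧ (h.Reduction he) + 2 = Module.finrank ℂ⟦X⟧ E := by
  have hle : (ABSubmodule.line he).toSubmodule ≤ (h.perp he).toSubmodule :=
    (Submodule.span_singleton_le_iff_mem _ _).mpr ((h.mem_perp he).mpr hee)
  have h1 : Module.finrank ℂ⟦X⟧ (E ⧸ (h.perp he).toSubmodule) = 1 := by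
    have hs : Function.Surjective (h.B e) := fun S => ⟨S • y₁, by
      rw [h.smul_right, hy₁, mul_one]⟩
    rw [← Module.finrank_self ℂ⟦X⟧]
    exact ((h.B e).quotKerEquivOfSurjective hs).finrank_eq
  have h2 : Module.finrank ℂ⟦X⟧ ((ABSubmodule.line he).within (h.perp he)).toSubmodule = 1 := by
    rw [← Module.finrank_self ℂ⟦X⟧]
    exact ((Submodule.submoduleOfEquivOfLe hle).trans
      (LinearEquiv.toSpanNonzeroSingleton ℂ⟦X⟧ E e he0).symm).finrank_eq
  have h3 := Submodule.finrank_quotient_add_finrank (h.perp he).toSubmodule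
  have h4 := Submodule.finrank_quotient_add_finrank
    ((ABSubmodule.line he).within (h.perp he)).toSubmodule
  change Module.finrank ℂ⟦X⟧ (h.Reduction he) + _ = _ at h4
  omega

end ABForm

/-! ### Self-adjoint composition series -/

/-- A self-adjoint Jordan–Hölder series of length `n`, indexed by natural numbers: only the
submodules `F 0, …, F n` and the parameters `l 0, …, l (n - 1)` matter. -/
def HasSelfAdjointSeries (E : Type u) [AddCommGroup E] [Module ℂ⟦X⟧ E] [ABStructure E]
    (n : ℕ) : Prop :=
  ∃ (F : ℕ → ABSubmodule E) (l : ℕ → ℂ), (F 0).toSubmodule = ⊥ ∧ (F n).toSubmodule = ⊤ ∧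
    (∀ j < n, (F j).toSubmodule ≤ (F (j + 1)).toSubmodule) ∧
    (∀ j ≤ n, ∀ x : E, (X : ℂ⟦X⟧) • x ∈ (F j).toSubmodule → x ∈ (F j).toSubmodule) ∧
    (∀ j < n, ABIsomorphic ((F (j + 1)).Quot (F j)) (ABElementary (l j))) ∧
    (∀ j < n, l (n - 1 - j) = -l j) ∧
    ∀ j, 2 * j ≤ n → ABSelfAdjoint ((F (n - j)).Quot (F j))

section Series

variable {E : Type u} [AddCommGroup E] [Module ℂ⟦X⟧ E] [ABStructure E]

theorem HasSelfAdjointSeries.exists_jordanHolder [Module.Finite ℂ⟦X⟧ E] {n : ℕ}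
    (hs : HasSelfAdjointSeries E n) : ∃ s : ABJordanHolder E n, s.IsSelfAdjoint := by
  obtain ⟨F, l, h0, hn, hle, hnormal, hiso, hl, hsa⟩ := hs
  refine ⟨⟨fun j => F j, h0, hn, fun j => ?_, fun j => ?_, fun j => l j, fun j => ?_⟩,
    fun j => ?_, fun j hj => ?_⟩
  · refine lt_of_le_not_ge (hle j j.2) fun hge => ?_
    obtain ⟨f, -⟩ := hiso j j.2
    -- The quotient is nonzero, being isomorphic to an elementary module.
    have h1 : ∀ x : (F (j + 1)).Quot (F j), x = 0 := fun x => by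
      induction x using Submodule.Quotient.induction_on with
      | H x => exact (Submodule.Quotient.mk_eq_zero _).mpr (hge x.2)
    have h2 : (1 : ℂ⟦X⟧) = 0 := by
      have h3 := (f.apply_symm_apply (show ABElementary (l j) from (1 : ℂ⟦X⟧)))
      rw [h1 (f.symm _), map_zero] at h3
      exact h3.symm
    exact one_ne_zero h2
  · exact (free_quotient_iff _).mpr (hnormal j (Nat.lt_succ_iff.mp j.2))
  · exact hiso j j.2
  · change l (Fin.rev j : ℕ) = -l j
    rw [← hl j j.2, Fin.val_rev]
    congr 1
    omega
  · change ABSelfAdjoint ((F (Fin.rev j : ℕ)).Quot (F j))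
    have : (Fin.rev j : ℕ) = n - j := by rw [Fin.val_rev]; omega
    rw [this]
    exact hsa j (by omega)

/-- A series of `e^⊥ / ⟨e⟩` gives one of `E`: its preimages are completed by `0` and `E`. -/
theorem HasSelfAdjointSeries.of_reduction [Module.Free ℂ⟦X⟧ E] (h : ABForm E) {l : ℂ} {e : E}
    (he : IsABEigen l e) {y₁ z : E} (hy₁ : h.B e y₁ = 1) (hz : h.B z e = 1)
    (hee : h.B e e = 0) {n : ℕ}
    (hs : HasSelfAdjointSeries (h.Reduction he) n) : HasSelfAdjointSeries E (n + 2) := by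
  obtain ⟨F, p, h0, hn, hle, hnormal, hiso, hp, hsa⟩ := hs
  let F' : ℕ → ABSubmodule E
    | 0 => .zero E
    | j + 1 => if j ≤ n then ABSubmodule.pull (F j) else .whole E
  let p' : ℕ → ℂ
    | 0 => l
    | j + 1 => if j < n then p j else -l
  have hF' : ∀ j ≤ n, F' (j + 1) = ABSubmodule.pull (F j) := fun j hj => if_pos hj
  have hFn : F' (n + 2) = .whole E := if_neg (by omega)
  have hF0 : F' 0 = .zero E := rfl
  have hp' : ∀ j < n, p' (j + 1) = p j := fun j hj => if_pos hj
  have hpn : p' (n + 1) = -l := if_neg (lt_irrefl n)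
  have hp0 : p' 0 = l := rfl
  have hmem0 : ∀ x, x ∈ (ABSubmodule.pull (F 0)).toSubmodule ↔
      x ∈ (ABSubmodule.line he).toSubmodule := by
    intro x
    rw [ABSubmodule.mem_pull, h0]
    constructor
    · rintro ⟨hx, hx'⟩
      exact (Submodule.Quotient.mk_eq_zero
        ((ABSubmodule.line he).within (h.perp he)).toSubmodule).mp ((Submodule.mem_bot _).mp hx')
    · intro hx
      refine ⟨?_, (Submodule.mem_bot _).mpr ((Submodule.Quotient.mk_eq_zero
        ((ABSubmodule.line he).within (h.perp he)).toSubmodule).mpr hx)⟩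
      obtain ⟨S, rfl⟩ := ABSubmodule.mem_line.mp hx
      rw [h.mem_perp, h.smul_right, hee, mul_zero]
  have hmemn : ∀ x, x ∈ (ABSubmodule.pull (F n)).toSubmodule ↔ h.B e x = 0 := by
    intro x
    rw [ABSubmodule.mem_pull, hn, ← h.mem_perp he]
    exact ⟨fun hx => hx.1, fun hx => ⟨hx, trivial⟩⟩
  refine ⟨F', p', rfl, by rw [hFn]; rfl, fun j hj => ?_, fun j hj x hx => ?_, fun j hj => ?_,
    fun j hj => ?_, fun j hj => ?_⟩
  · rcases j with _ | j
    · exact bot_le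
    · rcases (show j < n ∨ j = n by omega) with hjn | rfl
      · rw [hF' j hjn.le, hF' (j + 1) hjn]
        intro x hx
        obtain ⟨hxG, hx⟩ := ABSubmodule.mem_pull.mp hx
        exact ABSubmodule.mem_pull.mpr ⟨hxG, hle j hjn hx⟩
      · rw [hFn]
        exact le_top
  · rcases j with _ | j
    · refine (Submodule.mem_bot _).mpr (X_smul_injective ?_)
      rw [smul_zero]
      exact hx
    · rcases (show j ≤ n ∨ j = n + 1 by omega) with hjn | rfl
      · rw [hF' j hjn] at hx ⊢
        obtain ⟨hxG, hx⟩ := ABSubmodule.mem_pull.mp hx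
        have hxG' : x ∈ (h.perp he).toSubmodule := by
          rw [h.mem_perp, h.smul_right] at hxG
          exact (h.mem_perp he).mpr ((mul_eq_zero.mp hxG).resolve_left X_ne_zero)
        exact ABSubmodule.mem_pull.mpr ⟨hxG', hnormal j hjn _ hx⟩
      · rw [hFn]
        trivial
  · rcases j with _ | j
    · rw [hF' 0 n.zero_le, hF0, hp0]
      have hB : ∀ x : (ABSubmodule.pull (F 0)).toSubmodule, (x : E) = h.B z x • e := fun x => by
        obtain ⟨S, hS⟩ := ABSubmodule.mem_line.mp ((hmem0 x).mp x.2)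
        rw [← hS, h.smul_right, hz, mul_one]
      refine ABSubmodule.isomorphic_of_surjective (N := ABElementary l) _
        (show (ABSubmodule.pull (F 0)).toSubmodule →ₗ[ℂ⟦X⟧] ℂ⟦X⟧ from
          (h.B z).comp (ABSubmodule.pull (F 0)).toSubmodule.subtype)
        (fun x => ?_) (fun S => ?_) fun x => ?_
      · change h.B z (a (x : E)) = C l * X * h.B z x + X ^ 2 * derivative ℂ (h.B z x)
        conv_lhs => rw [hB x, a_smul, he, map_add, h.smul_right, h.smul_right, h.smul_right, hz]
        ring
      · refine ⟨⟨(show ℂ⟦X⟧ from S) • e,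
          (hmem0 _).mpr (ABSubmodule.mem_line.mpr ⟨_, rfl⟩)⟩, ?_⟩
        change h.B z ((show ℂ⟦X⟧ from S) • e) = S
        rw [h.smul_right, hz]
        exact mul_one (show ℂ⟦X⟧ from S)
      · change (x : E) ∈ (⊥ : Submodule ℂ⟦X⟧ E) ↔ h.B z x = 0
        rw [Submodule.mem_bot]
        exact ⟨fun hx => by rw [hx, map_zero], fun hx => by rw [hB x, hx, zero_smul]⟩
    · rcases (show j < n ∨ j = n by omega) with hjn | rfl
      · rw [hF' j hjn.le, hF' (j + 1) hjn, hp' j hjn]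
        obtain ⟨f, hf⟩ := ABSubmodule.pull_quot_isomorphic (F (j + 1)) (F j)
        obtain ⟨g, hg⟩ := hiso j hjn
        exact ⟨f.trans g, fun x => by
          rw [LinearEquiv.trans_apply, hf, hg, LinearEquiv.trans_apply]⟩
      · rw [hF' j le_rfl, hFn, hpn]
        exact h.quot_perp_isomorphic he hy₁ rfl hmemn
  · rcases j with _ | j
    · rw [show n + 2 - 1 - 0 = n + 1 by omega, hpn, hp0]
    · rcases (show j < n ∨ j = n by omega) with hjn | rfl
      · rw [show n + 2 - 1 - (j + 1) = (n - 1 - j) + 1 by omega, hp' j hjn,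
          hp' (n - 1 - j) (by omega), hp j hjn]
      · rw [show j + 2 - 1 - (j + 1) = 0 by omega, hpn, hp0, neg_neg]
  · rcases j with _ | j
    · rw [Nat.sub_zero, hFn, hF0]
      exact (abSelfAdjoint_iff_nonempty_form.mpr ⟨h⟩).of_isomorphic
        (ABSubmodule.quot_isomorphic_self rfl rfl)
    · rw [show n + 2 - (j + 1) = (n - j) + 1 by omega, hF' (n - j) (by omega),
        hF' j (by omega)]
      exact (hsa j (by omega)).of_isomorphic (ABSubmodule.pull_quot_isomorphic _ _)

end Series

/-- A self-adjoint regular module of rank one is isomorphic to `E_0`: its generator `e`, of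
parameter `l`, pairs with itself to a unit, while `B e e` is a multiple of `b ^ (2 l)`. -/
theorem hasSelfAdjointSeries_one {E : Type u} [AddCommGroup E] [Module ℂ⟦X⟧ E] [ABStructure E]
    [Module.Free ℂ⟦X⟧ E] [Module.Finite ℂ⟦X⟧ E] (h : ABForm E) (hreg : ABRegular E)
    (hn : Module.finrank ℂ⟦X⟧ E = 1) : HasSelfAdjointSeries E 1 := by
  have : Nontrivial E := Module.nontrivial_of_finrank_pos (R := ℂ⟦X⟧) (by omega)
  obtain ⟨l, v, hv0, hv⟩ := hreg.exists_eigen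
  obtain ⟨k, e, rfl, he⟩ := exists_primitive hv0
  have hle := hv.of_X_pow_smul
  obtain ⟨y₁, hy₁⟩ := h.exists_apply_eq_one he
  have hinj : ∀ x, h.B e x = 0 → x = 0 := by
    have hs : Function.Surjective (h.B e) := fun S => ⟨S • y₁, by
      rw [h.smul_right, hy₁, mul_one]⟩
    have h1 := (h.B e).quotKerEquivOfSurjective hs |>.finrank_eq
    have h2 := Submodule.finrank_quotient_add_finrank (LinearMap.ker (h.B e))
    rw [Module.finrank_self] at h1
    have h3 : LinearMap.ker (h.B e) = ⊥ := Submodule.finrank_eq_zero.mp (by omega)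
    exact LinearMap.ker_eq_bot'.mp h3
  -- `e = B e e y₁`, and `e` is primitive.
  have hunit : coeff 0 (h.B e e) ≠ 0 := by
    intro h0
    rw [coeff_zero_eq_constantCoeff_apply, ← X_dvd_iff] at h0
    obtain ⟨S, hS⟩ := h0
    refine he (S • y₁) (sub_eq_zero.mp (hinj _ ?_))
    rw [map_sub, h.smul_right, h.smul_right, hy₁, hS, mul_one, sub_self]
  have hl : l - k = 0 := by
    have h1 := h.coeff_eigen hle hle 0
    rw [Nat.cast_zero, zero_mul] at h1
    have h2 := (mul_eq_zero.mp h1.symm).resolve_right hunit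
    linear_combination h2 / 2
  rw [hl] at hle
  have hiso := h.quot_perp_isomorphic hle hy₁ (A := .whole E) (K := .zero E) rfl fun x =>
    ⟨fun hx => by rw [(Submodule.mem_bot _).mp hx, map_zero], fun hx => hinj x hx⟩
  rw [neg_zero] at hiso
  refine ⟨fun j => if j = 0 then .zero E else .whole E, fun _ => 0, rfl, rfl, fun j hj => ?_,
    fun j hj x hx => ?_, fun j hj => ?_, fun _ _ => neg_zero.symm, fun j hj => ?_⟩
  · obtain rfl : j = 0 := by omega
    exact bot_le
  · rcases (show j = 0 ∨ j = 1 by omega) with rfl | rfl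
    · refine (Submodule.mem_bot _).mpr (X_smul_injective ?_)
      rw [smul_zero]
      exact hx
    · trivial
  · obtain rfl : j = 0 := by omega
    exact hiso
  · obtain rfl : j = 0 := by omega
    exact (abSelfAdjoint_iff_nonempty_form.mpr ⟨h⟩).of_isomorphic
      (ABSubmodule.quot_isomorphic_self rfl rfl)

/-- Induction on the rank: an isotropic eigenvector `e` of the asymmetry, made primitive, reduces
`E` to `e^⊥ / ⟨e⟩`, whose rank is smaller by two. -/
theorem hasSelfAdjointSeries : ∀ (n : ℕ) (E : Type u) [AddCommGroup E] [Module ℂ⟦X⟧ E]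
    [ABStructure E] [Module.Free ℂ⟦X⟧ E] [Module.Finite ℂ⟦X⟧ E],
    ABForm E → ABRegular E → Module.finrank ℂ⟦X⟧ E = n → HasSelfAdjointSeries E n
  | 0, E, _, _, _, _, _, h, _, hn => by
    have : Subsingleton E := Module.finrank_zero_iff.mp hn
    exact ⟨fun _ => .whole E, fun _ => 0, Subsingleton.elim _ _, rfl,
      fun _ hj => absurd hj (Nat.not_lt_zero _), fun _ _ _ _ => trivial,
      fun _ hj => absurd hj (Nat.not_lt_zero _), fun _ hj => absurd hj (Nat.not_lt_zero _),
      fun _ _ => (abSelfAdjoint_iff_nonempty_form.mpr ⟨h⟩).of_isomorphic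
        (ABSubmodule.quot_isomorphic_self rfl (Subsingleton.elim _ _))⟩
  | 1, E, _, _, _, _, _, h, hreg, hn => hasSelfAdjointSeries_one h hreg hn
  | n + 2, E, _, _, _, _, _, h, hreg, hn => by
    obtain ⟨u, hu, hua, hu0⟩ := h.exists_asymmetry
    obtain ⟨l, v, c, hv0, hv, hcv, hvv⟩ := h.exists_isotropic hreg (by omega) hu hua
    obtain ⟨k, e, rfl, he⟩ := exists_primitive hv0
    have hle := hv.of_X_pow_smul
    have he0 : e ≠ 0 := fun h0 => hv0 (by rw [h0, smul_zero])
    have hce : u e = (C c : ℂ⟦X⟧) • e := X_pow_smul_injective k (by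
      rw [← map_smul, hcv, smul_comm])
    have hee : h.B e e = 0 := by
      rw [h.smul_left, h.smul_right, map_pow, evalNegHom_X] at hvv
      exact (mul_eq_zero.mp ((mul_eq_zero.mp hvv).resolve_left
        (pow_ne_zero k (neg_ne_zero.mpr X_ne_zero)))).resolve_left (pow_ne_zero k X_ne_zero)
    have hc : c ≠ 0 := fun h0 => he0 (hu0 e (by rw [hce, h0, map_zero, zero_smul]))
    have hC : (C c : ℂ⟦X⟧) ≠ 0 := fun h0 => hc (C_injective (h0.trans (map_zero _).symm))
    have hswap : ∀ x, evalNegHom (h.B x e) = C c * h.B e x := fun x => by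
      rw [← hu, hce, h.C_smul_left]
    have hright : ∀ x, h.B e x = 0 ↔ h.B x e = 0 := fun x => by
      rw [← evalNegHom_injective.eq_iff (a := h.B x e), hswap, map_zero, mul_eq_zero]
      exact ⟨Or.inr, fun h0 => h0.resolve_left hC⟩
    obtain ⟨y₁, hy₁⟩ := h.exists_apply_eq_one he
    obtain ⟨z, hz⟩ : ∃ z, h.B z e = 1 := by
      refine ⟨(C c⁻¹ : ℂ⟦X⟧) • y₁, evalNegHom_injective ?_⟩
      rw [h.C_smul_left, map_mul, hswap, hy₁, mul_one, ABConj.evalNegHom_C, ← map_mul,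
        inv_mul_cancel₀ hc, map_one, map_one]
    obtain ⟨h'⟩ := h.nonempty_form_reduction hle hright hee hy₁
    have hnormal : ∀ x : (h.perp hle).toSubmodule,
        (X : ℂ⟦X⟧) • x ∈ ((ABSubmodule.line hle).within (h.perp hle)).toSubmodule →
          x ∈ ((ABSubmodule.line hle).within (h.perp hle)).toSubmodule :=
      fun x hx => h.X_smul_mem_line hle hz hx
    have : Module.Free ℂ⟦X⟧ (h.Reduction hle) := (free_quotient_iff _).mpr hnormal
    exact .of_reduction h hle hy₁ hz hee (hasSelfAdjointSeries n _ h'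
      ((hreg.of_injective (h.perp hle).toSubmodule.subtype (fun _ => rfl)
        (Submodule.subtype_injective _)).quotient _ hnormal)
      (by have := h.finrank_reduction hle he0 hee hy₁; omega))

theorem theorem2 (E : Type u) [AddCommGroup E] [Module ℂ⟦X⟧ E] [ABModule E]
    (hreg : ABRegular E) (hsa : ABSelfAdjoint E) :
    ∃ s : ABJordanHolder E (Module.finrank ℂ⟦X⟧ E), s.IsSelfAdjoint := by
  obtain ⟨h⟩ := abSelfAdjoint_iff_nonempty_form.mp hsa
  exact (hasSelfAdjointSeries _ E h hreg rfl).exists_jordanHolder
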